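/- **Setting.** Let $X,Y$ be complex Banach spaces, $D(A)\subset X$ a dense subspace, and $A:D(A)\to X$, $\partial:D(A)\to Y$ linear, such that: (A1) $\partial$ is onto; (A2) $\operatorname{Ker}\partial$ is dense in $X$ and the restriction $A_0$ of $A$ to $\operatorname{Ker}\partial$ generates a $C_0$-semigroup $e^{tA_0}$ of negative type $\omega$; (A3) for $\operatorname{Re}z>\omega$ and $v\in Y$ the problem $Ax=zx$, $\partial x=v$ has a unique solution $x=K(z)v$, and for each $\omega_0>\omega$ there is $L$ with $\|K(z)v\|\le L\|v\|$ whenever $\operatorname{Re} z>\omega_0$. Put $\varphi_0(tA_0)=e^{tA_0}$ and $\varphi_j(tA_0)=t^{-j}\int_0^te^{(t-\tau)A_0}\frac{\tau^{j-1}}{(j-1)!}\,d\tau$ for $j\ge1$, $t>0$ (same notation for other generators). Let $T>0$, $p\ge 1$, and let $u$ solve $u'=Au+f$, $u(0)=u_0$, $\partial u=g$ on $[0,T]$, with $A^lu^{(j)}\in C([0,T],X)$ for $l+j\le p+1$ and $(A^lu)^{(j)}=A^lu^{(j)}$. Let $Z\subset D(A)$ be a subspace with its own norm $\|\cdot\|_Z$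 such that, for $1\le j\le s$, $0<t\le T$, the operators $t^p\varphi_{p+j}(tA_0)$ map $Z$ into $Z$ with a bound on $Z$ uniform in $t$. Assume $A^ju\in C([0,T],Z)$ for $0\le j\le p+1$ and $A^jf\in C([0,T],Z)$ for $0\le j\le p$. Let $c_1,\dots,c_s\in[0,1]$ ($s\ge1$) be distinct, with Lagrange polynomials $l_i(\theta)=\sum_{j=1}^s a_{i,j}\theta^{j-1}/(j-1)!$. **Space discretization.** For parameters $h$ in a sequence of positive numbers tending to $0$, let $X_h\subset X$ be a finite dimensional subspace with a norm $\|\cdot\|_h$, $X_{h,0}\subset X_h$ a subspace, $L_h:X\to X_{h,0}$ a linear projection, $Q_h:Y\to X_h$, $A_h:X_h\to X_{h,0}$ linear, and $A_{h,0}:X_{h,0}\to X_{h,0}$ linear and invertible. Put $P_h=L_h-L_hQ_h\partial$ and define $R_h:D(A)\to X_{h,0}$ by $A_{h,0}R_hw+A_hQ_h\partial w=L_hAw$. Assume that $\|e^{tA_{h,0}}\|_h$ ($t\ge0$), $\|L_h\|_{X\to X_h}$, $\|L_hQ_h\|_{Y\to X_h}$ and, for small $h$, $\|A_{h,0}^{-1}A_hQ_h\|_{Y\to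 X_h}$ are bounded independently of $h$, and that $\|A_{h,0}(R_h-P_h)z\|_h\le\varepsilon_h\|z\|_Z$ for $z\in Z$, where $\varepsilon_h\ge0$ does not increase as $h$ decreases. **Scheme.** Let $k>0$, $t_n=nk$, $U_{h,0}=P_hu_0$ and $U_{h,n+1}=V_{h,n,0}+k\sum_{i,j=1}^sa_{i,j}V_{h,j,n,i}$, where $$V_{h,n,0}=e^{kA_{h,0}}U_{h,n}+\sum_{j=1}^pk^j\varphi_j(kA_{h,0})\big[A_hQ_h\partial A^{j-1}u(t_n)-L_hQ_h\partial A^ju(t_n)\big]+k^{p+1}\varphi_{p+1}(kA_{h,0})A_hQ_h\partial A^pu(t_n)$$ and, with $f_{n,i}=f(t_n+c_ik)$, $$V_{h,j,n,i}=\varphi_j(kA_{h,0})P_hf_{n,i}+\sum_{l=0}^{p-2}k^{l+1}\varphi_{j+l+1}(kA_{h,0})\big[A_hQ_h\partial A^lf_{n,i}-L_hQ_h\partial A^{l+1}f_{n,i}\big]+k^p\varphi_{p+j}(kA_{h,0})A_hQ_h\partial A^{p-1}f_{n,i}.$$ Let $\rho_n=u(t_{n+1})-\bar u_{n+1}$ be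 the local error of the time semidiscretization, where $$\bar u_{n+1}=\sum_{l=0}^p\frac{k^l}{l!}A^lu(t_n)+k^{p+1}\varphi_{p+1}(kA_0)A^{p+1}u(t_n)+k\sum_{i,j=1}^sa_{i,j}\Big[\sum_{l=0}^{p-1}\frac{k^l}{(l+j)!}A^lf_{n,i}+k^p\varphi_{p+j}(kA_0)A^pf_{n,i}\Big],$$ and let $e_{h,n}=P_hu(t_n)-U_{h,n}$. **Theorem.** In each part, the constant $C$ does not depend on $h$, $k$ and $n$. 1. If the operators $P_h$ are bounded independently of $h$, i.e. $\|P_hz\|_h\le C_P\|z\|_X$ for $z\in Z$ and all $h$, then there is $C$ such that for all $h$, all $k>0$ and all $n$ with $nk\le T$, $$\|e_{h,n}\|_h\le C\Big(\frac1k\max_{0\le l\le n-1}\|\rho_l\|_X+\varepsilon_h\Big).$$ 2. Without the assumption on $P_h$ in part 1, there is $C$ such that for all $h$, all $k>0$ and all $n$ with $nk\le T$, $$\|e_{h,n}\|_h\le C\Big(\frac1k\max_{0\le l\le n-1}\big(\|\rho_l\|_X+\|\partial\rho_l\|_Y\big)+\varepsilon_h\Big).$$ 3. There is $C$ such that for all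 $k>0$, $n\ge0$ with $(n+1)k\le T$, $$\Big\|\rho_n-\sum_{m=1}^pk^m\sum_{r=0}^{m-1}\Big(\frac1{m!}-\frac1{r!}\sum_{l=1}^s\frac1{(m-r-1+l)!}\sum_{i=1}^sc_i^ra_{i,l}\Big)A^{m-r-1}f^{(r)}(t_n)\Big\|\le Ck^{p+1}.$$ If moreover the interpolatory quadrature rule with nodes $c_i$ on $[0,1]$ is exact for polynomials of degree $\le p-1$, then $\|\rho_n\|\le Ck^{p+1}$ for all such $k,n$. (For $n=0$ the maxima are $0$.) -/

import Mathlib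

open Set Filter Topology
open scoped Nat

noncomputable section

/-- The unbounded operators of an abstract initial boundary value problem: a linear operator `A`
and a boundary operator `bd`, both defined on the subspace `dom = D(A)` of `X`. -/
structure BoundaryPair (X Y : Type*) [NormedAddCommGroup X] [NormedSpace ℂ X]
    [NormedAddCommGroup Y] [NormedSpace ℂ Y] where
  dom : Submodule ℂ X
  A : dom →ₗ[ℂ] X
  bd : dom →ₗ[ℂ] Y

namespace BoundaryPair

variable {X Y : Type*} [NormedAddCommGroup X] [NormedSpace ℂ X]
  [NormedAddCommGroup Y] [NormedSpace ℂ Y]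

open scoped Classical in
/-- `A x`, with the value `0` outside `D(A)`. -/
def op (B : BoundaryPair X Y) (x : X) : X := if h : x ∈ B.dom then B.A ⟨x, h⟩ else 0

open scoped Classical in
/-- `∂ x`, with the value `0` outside `D(A)`. -/
def trace (B : BoundaryPair X Y) (x : X) : Y := if h : x ∈ B.dom then B.bd ⟨x, h⟩ else 0

/-- `A ^ l x`; meaningful for `x ∈ D(A ^ l)`. -/
def pow (B : BoundaryPair X Y) (l : ℕ) (x : X) : X := B.op^[l] x

/-- `x ∈ D(A ^ l)`. -/
def MemDomPow (B : BoundaryPair X Y) (l : ℕ) (x : X) : Prop := ∀ i < l, B.pow i x ∈ B.dom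

/-- The set `Ker ∂ = D(A₀)`. -/
def ker (B : BoundaryPair X Y) : Set X := {x | x ∈ B.dom ∧ B.trace x = 0}

end BoundaryPair

/-- A `C₀`-semigroup of bounded operators, `S t = e ^ (t G)`, `t ≥ 0`. -/
structure IsC0Semigroup {E : Type*} [NormedAddCommGroup E] [NormedSpace ℂ E]
    (S : ℝ → E →L[ℂ] E) : Prop where
  zero : S 0 = ContinuousLinearMap.id ℂ E
  add : ∀ s t : ℝ, 0 ≤ s → 0 ≤ t → S (s + t) = (S s).comp (S t)
  cont : ∀ x : E, ContinuousOn (fun t => S t x) (Ici 0)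

/-- The type (growth bound) of a semigroup: the infimum, in `[-∞, ∞]`, of the reals `w` such that
`‖S t‖ ≤ M e ^ (w t)` for some `M` and all `t ≥ 0`. -/
def semigroupType {E : Type*} [NormedAddCommGroup E] [NormedSpace ℂ E]
    (S : ℝ → E →L[ℂ] E) : EReal :=
  sInf ((fun w : ℝ => (w : EReal)) ''
    {w : ℝ | ∃ M : ℝ, ∀ t : ℝ, 0 ≤ t → ‖S t‖ ≤ M * Real.exp (w * t)})

/-- The operators `φ_j(t G)` of the semigroup `S t = e ^ (t G)`, for `t > 0`:
`φ_0(t G) = S t` and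
`φ_j(t G) x = t ^ (-j) ∫_0^t S (t - τ) x τ ^ (j - 1) / (j - 1)! dτ` for `j ≥ 1`. -/
def phi {E : Type*} [NormedAddCommGroup E] [NormedSpace ℂ E]
    (S : ℝ → E →L[ℂ] E) : ℕ → ℝ → E → E
  | 0, t, x => S t x
  | j + 1, t, x => (1 / t ^ (j + 1) : ℝ) • ∫ τ in (0 : ℝ)..t, (τ ^ j / (j ! : ℝ)) • S (t - τ) x

/-- Assumptions (A1)-(A3) on the operators `A` and `∂`; `S` is the semigroup generated by the
restriction `A₀` of `A` to `Ker ∂`. -/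
structure BoundaryPair.Admissible {X Y : Type*} [NormedAddCommGroup X] [NormedSpace ℂ X]
    [NormedAddCommGroup Y] [NormedSpace ℂ Y] (B : BoundaryPair X Y) (S : ℝ → X →L[ℂ] X) :
    Prop where
  dense_dom : Dense (B.dom : Set X)
  bd_surjective : Function.Surjective B.bd
  dense_ker : Dense B.ker
  semigroup : IsC0Semigroup S
  generator : ∀ x y : X,
    Tendsto (fun t : ℝ => (1 / t : ℝ) • (S t x - x)) (𝓝[>] 0) (𝓝 y) ↔ x ∈ B.ker ∧ B.op x = y
  type_neg : semigroupType S < 0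
  steady : ∀ z : ℂ, semigroupType S < (z.re : EReal) → ∀ v : Y,
    ∃! x : X, x ∈ B.dom ∧ B.op x = z • x ∧ B.trace x = v
  steady_bound : ∀ w : ℝ, semigroupType S < (w : EReal) → ∃ K : ℝ, ∀ z : ℂ, w < z.re →
    ∀ x ∈ B.dom, B.op x = z • x → ‖x‖ ≤ K * ‖B.trace x‖

/-- `u` solves `u' = A u + f`, `u(0) = u₀`, `∂ u = g` on `[0, T]`. -/
structure IsIBVPSolution {X Y : Type*} [NormedAddCommGroup X] [NormedSpace ℂ X]
    [NormedAddCommGroup Y] [NormedSpace ℂ Y] (B : BoundaryPair X Y) (T : ℝ) (u₀ : X)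
    (f : ℝ → X) (g : ℝ → Y) (u : ℝ → X) : Prop where
  mem_dom : ∀ t ∈ Icc 0 T, u t ∈ B.dom
  deriv : ∀ t ∈ Icc 0 T, HasDerivWithinAt u (B.op (u t) + f t) (Icc 0 T) t
  init : u 0 = u₀
  boundary : ∀ t ∈ Icc 0 T, B.trace (u t) = g t

/-- Regularity of the solution: the time derivatives up to order `p + 1` are regular in space,
`A ^ l u^(j)` is continuous for `l + j ≤ p + 1`, and powers of `A` commute with time
differentiation. -/
structure IsRegularSolution {X Y : Type*} [NormedAddCommGroup X] [NormedSpace ℂ X]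
    [NormedAddCommGroup Y] [NormedSpace ℂ Y] (B : BoundaryPair X Y) (T : ℝ) (p : ℕ)
    (u : ℝ → X) : Prop where
  contDiff : ∀ l j : ℕ, l + j = p + 1 → ContDiffOn ℝ j (fun t => B.pow l (u t)) (Icc 0 T)
  mem_dom : ∀ l j : ℕ, l + j ≤ p + 1 → ∀ t ∈ Icc 0 T,
    B.MemDomPow l (iteratedDerivWithin j u (Icc 0 T) t)
  commute : ∀ l j : ℕ, l + j ≤ p + 1 → ∀ t ∈ Icc 0 T,
    iteratedDerivWithin j (fun r => B.pow l (u r)) (Icc 0 T) t =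
      B.pow l (iteratedDerivWithin j u (Icc 0 T) t)

/-- `v ∈ C([0, T], Z)`, where the subspace `Z` of `X` with its own norm is given by its
inclusion `ι`. -/
def ContinuousInto {X Z : Type*} [NormedAddCommGroup X] [NormedSpace ℂ X]
    [NormedAddCommGroup Z] [NormedSpace ℂ Z] (ι : Z →ₗ[ℂ] X) (T : ℝ) (v : ℝ → X) : Prop :=
  ∃ w : ℝ → Z, ContinuousOn w (Icc 0 T) ∧ ∀ t ∈ Icc 0 T, ι (w t) = v t

/-- The Lagrange basis polynomial `l_i` of the nodes `c`. -/
def lagrangePoly {s : ℕ} (c : Fin s → ℝ) (i : Fin s) : Polynomial ℝ :=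
  Lagrange.basis Finset.univ c i

/-- The numbers `a_{i,j}`, `1 ≤ j ≤ s`, with `l_i(θ) = ∑_j a_{i,j} θ ^ (j - 1) / (j - 1)!`.
The second index is counted from `0` here: `quadCoeff c i j` is `a_{i,j+1}`. -/
def quadCoeff {s : ℕ} (c : Fin s → ℝ) (i j : Fin s) : ℝ :=
  ((j : ℕ)! : ℝ) * (lagrangePoly c i).coeff j

/-- The interpolatory quadrature rule on `[0, 1]` with nodes `c` integrates exactly all
polynomials of degree less than `p`. -/
def QuadExact {s : ℕ} (c : Fin s → ℝ) (p : ℕ) : Prop :=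
  ∀ q : Polynomial ℝ, q.degree < p →
    ∫ θ in (0 : ℝ)..1, q.eval θ =
      ∑ i, (∫ θ in (0 : ℝ)..1, (lagrangePoly c i).eval θ) * q.eval (c i)

section TimeDiscretization

variable {X Y : Type*} [NormedAddCommGroup X] [NormedSpace ℂ X]
  [NormedAddCommGroup Y] [NormedSpace ℂ Y]

/-- One step of size `k`, from time `t` and value `x`, of the exponential quadrature rule
continuous in space. -/
def timeStep (B : BoundaryPair X Y) (S : ℝ → X →L[ℂ] X) (p : ℕ) {s : ℕ} (c : Fin s → ℝ)
    (f : ℝ → X) (k t : ℝ) (x : X) : X :=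
  ∑ l ∈ Finset.range (p + 1), (k ^ l / (l ! : ℝ)) • B.pow l x
    + k ^ (p + 1) • phi S (p + 1) k (B.pow (p + 1) x)
    + k • ∑ i : Fin s, ∑ j : Fin s, quadCoeff c i j •
      (∑ l ∈ Finset.range p, (k ^ l / ((l + (j + 1))! : ℝ)) • B.pow l (f (t + c i * k))
        + k ^ p • phi S (p + (j + 1)) k (B.pow p (f (t + c i * k))))

/-- The local truncation error `ρ_n = u(t_{n+1}) - ū_{n+1}` of the time semidiscretization,
`t_n = n k`. -/
def timeLocalError (B : BoundaryPair X Y) (S : ℝ → X →L[ℂ] X) (p : ℕ) {s : ℕ} (c : Fin s → ℝ)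
    (f u : ℝ → X) (k : ℝ) (n : ℕ) : X :=
  u (((n + 1 : ℕ) : ℝ) * k) - timeStep B S p c f k (n * k) (u (n * k))

/-- The polynomial part, in the step size `k`, of the expansion of `ρ_n`:
`∑_{m=1}^p k ^ m ∑_{r=0}^{m-1} (1/m! - (1/r!) ∑_l 1/(m-r-1+l)! ∑_i c_i ^ r a_{i,l})
A ^ (m-r-1) f^(r)(t_n)`, with `m = m' + 1`, `l = l' + 1`. -/
def localErrorExpansion (B : BoundaryPair X Y) (T : ℝ) (p : ℕ) {s : ℕ} (c : Fin s → ℝ)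
    (f : ℝ → X) (k : ℝ) (n : ℕ) : X :=
  ∑ m ∈ Finset.range p, k ^ (m + 1) • ∑ r ∈ Finset.range (m + 1),
    (1 / ((m + 1)! : ℝ) - 1 / (r ! : ℝ) *
      ∑ l : Fin s, 1 / ((m - r + (l + 1))! : ℝ) * ∑ i : Fin s, c i ^ r * quadCoeff c i l) •
      B.pow (m - r) (iteratedDerivWithin r f (Icc 0 T) (n * k))

end TimeDiscretization

/-- The semigroup `e ^ (t G)` of a bounded operator `G` (operator exponential series). -/
def expSemigroup {E : Type*} [NormedAddCommGroup E] [NormedSpace ℂ E] (G : E →L[ℂ] E) (t : ℝ) :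
    E →L[ℂ] E :=
  NormedSpace.exp ((t : ℂ) • G)

/-- One abstract space discretization, for one value of the parameter `h`: the finite dimensional
subspace `X_h` of `X` (the type `Xh`, which carries its own norm `‖·‖_h`, with its inclusion
`emb`), its subspace `X_{h,0}`, the invertible operator `A_{h,0}`, the operator `A_h`, the boundary
discretization `Q_h` and the projection `L_h` onto `X_{h,0}`. -/
structure SpaceDiscretization (X Y Xh : Type*) [NormedAddCommGroup X] [NormedSpace ℂ X]
    [NormedAddCommGroup Y] [NormedSpace ℂ Y] [NormedAddCommGroup Xh] [NormedSpace ℂ Xh] where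
  emb : Xh →ₗ[ℂ] X
  emb_injective : Function.Injective emb
  X0 : Submodule ℂ Xh
  A0 : X0 ≃ₗ[ℂ] X0
  Ah : Xh →ₗ[ℂ] X0
  Q : Y →ₗ[ℂ] Xh
  L : X →ₗ[ℂ] X0
  L_proj : ∀ x : X0, L (emb x) = x

namespace SpaceDiscretization

variable {X Y Xh : Type*} [NormedAddCommGroup X] [NormedSpace ℂ X]
  [NormedAddCommGroup Y] [NormedSpace ℂ Y] [NormedAddCommGroup Xh] [NormedSpace ℂ Xh]

/-- `L_h Q_h`. -/
def LQ (D : SpaceDiscretization X Y Xh) (v : Y) : D.X0 := D.L (D.emb (D.Q v))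

/-- `A_h Q_h`. -/
def AQ (D : SpaceDiscretization X Y Xh) (v : Y) : D.X0 := D.Ah (D.Q v)

/-- `P_h = L_h - L_h Q_h ∂`. -/
def P (D : SpaceDiscretization X Y Xh) (B : BoundaryPair X Y) (x : X) : D.X0 :=
  D.L x - D.LQ (B.trace x)

/-- The elliptic projection `R_h`: the solution of `A_{h,0} R_h x + A_h Q_h ∂ x = L_h A x`. -/
def R (D : SpaceDiscretization X Y Xh) (B : BoundaryPair X Y) (x : X) : D.X0 :=
  D.A0.symm (D.L (B.op x) - D.AQ (B.trace x))

/-- The semigroup `e ^ (t A_{h,0})`. -/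
def semigroup [FiniteDimensional ℂ Xh] (D : SpaceDiscretization X Y Xh) (t : ℝ) :
    D.X0 →L[ℂ] D.X0 :=
  expSemigroup (LinearMap.toContinuousLinearMap (D.A0 : D.X0 →ₗ[ℂ] D.X0)) t

/-- The term `V_{h,n,0}(k)`, started from `U` at time `t = t_n`. -/
def V0 [FiniteDimensional ℂ Xh] (D : SpaceDiscretization X Y Xh) (B : BoundaryPair X Y)
    (p : ℕ) (u : ℝ → X) (k t : ℝ) (U : D.X0) : D.X0 :=
  phi D.semigroup 0 k U
    + ∑ j ∈ Finset.Icc 1 p, k ^ j • phi D.semigroup j k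
        (D.AQ (B.trace (B.pow (j - 1) (u t))) - D.LQ (B.trace (B.pow j (u t))))
    + k ^ (p + 1) • phi D.semigroup (p + 1) k (D.AQ (B.trace (B.pow p (u t))))

/-- The term `V_{h,j,n,i}(k)`, where `x = f(t_n + c_i k)`, for `j, p ≥ 1`. -/
def V [FiniteDimensional ℂ Xh] (D : SpaceDiscretization X Y Xh) (B : BoundaryPair X Y)
    (p j : ℕ) (k : ℝ) (x : X) : D.X0 :=
  phi D.semigroup j k (D.P B x)
    + ∑ l ∈ Finset.range (p - 1), k ^ (l + 1) • phi D.semigroup (j + l + 1) k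
        (D.AQ (B.trace (B.pow l x)) - D.LQ (B.trace (B.pow (l + 1) x)))
    + k ^ p • phi D.semigroup (p + j) k (D.AQ (B.trace (B.pow (p - 1) x)))

/-- The fully discrete numerical solution `U_{h,n}`. -/
def scheme [FiniteDimensional ℂ Xh] (D : SpaceDiscretization X Y Xh) (B : BoundaryPair X Y)
    (p : ℕ) {s : ℕ} (c : Fin s → ℝ) (u₀ : X) (f u : ℝ → X) (k : ℝ) : ℕ → D.X0
  | 0 => D.P B u₀
  | n + 1 => D.V0 B p u k (n * k) (scheme D B p c u₀ f u k n)
      + k • ∑ i : Fin s, ∑ j : Fin s, quadCoeff c i j • D.V B p (j + 1) k (f (n * k + c i * k))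

end SpaceDiscretization

/-- Hypotheses on a family of space discretizations, with parameters `h m → 0` and consistency
bounds `ε m = ε_h`, and on the subspace `Z` with inclusion `ι`:
* uniformly bounded discrete semigroups, and bounded `L_h` and `L_h Q_h`;
* `‖A_{h,0} (R_h - P_h) z‖_h ≤ ε_h ‖z‖_Z`;
* the discrete maximum principle (HS): `A_{h,0}⁻¹ A_h Q_h` is bounded for small `h`. -/
structure DiscretizationFamily {X Y Z : Type*} [NormedAddCommGroup X] [NormedSpace ℂ X]
    [NormedAddCommGroup Y] [NormedSpace ℂ Y] [NormedAddCommGroup Z] [NormedSpace ℂ Z]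
    (B : BoundaryPair X Y) (ι : Z →ₗ[ℂ] X) {Xh : ℕ → Type*}
    [∀ m, NormedAddCommGroup (Xh m)] [∀ m, NormedSpace ℂ (Xh m)]
    [∀ m, FiniteDimensional ℂ (Xh m)] (D : ∀ m, SpaceDiscretization X Y (Xh m))
    (h ε : ℕ → ℝ) : Prop where
  h_pos : ∀ m, 0 < h m
  h_lim : Tendsto h atTop (𝓝 0)
  ε_nonneg : ∀ m, 0 ≤ ε m
  ε_mono : ∀ m m', h m ≤ h m' → ε m ≤ ε m'
  stable : ∃ M : ℝ, ∀ m, ∀ t : ℝ, 0 ≤ t → ∀ U : (D m).X0, ‖(D m).semigroup t U‖ ≤ M * ‖U‖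
  L_bound : ∃ C : ℝ, ∀ m, ∀ x : X, ‖(D m).L x‖ ≤ C * ‖x‖
  LQ_bound : ∃ C : ℝ, ∀ m, ∀ v : Y, ‖(D m).LQ v‖ ≤ C * ‖v‖
  consistent : ∀ m, ∀ z : Z, ‖(D m).A0 ((D m).R B (ι z) - (D m).P B (ι z))‖ ≤ ε m * ‖z‖
  max_principle : ∃ C h₀ : ℝ, 0 < h₀ ∧ ∀ m, h m < h₀ → ∀ v : Y,
    ‖(D m).A0.symm ((D m).AQ v)‖ ≤ C * ‖v‖

/-- The part of the hypotheses on `Z` that concerns the exact problem: `Z` is a subspace of `D(A)`,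
and the operators `t ^ p φ_{p+j}(t A₀)`, `1 ≤ j ≤ s`, `0 < t ≤ T`, map `Z` into `Z` and are
uniformly bounded there. -/
structure SmoothSubspace {X Y Z : Type*} [NormedAddCommGroup X] [NormedSpace ℂ X]
    [NormedAddCommGroup Y] [NormedSpace ℂ Y] [NormedAddCommGroup Z] [NormedSpace ℂ Z]
    (B : BoundaryPair X Y) (S : ℝ → X →L[ℂ] X) (ι : Z →ₗ[ℂ] X) (T : ℝ) (p s : ℕ) : Prop where
  injective : Function.Injective ι
  le_dom : ∀ z, ι z ∈ B.dom
  phi_bound : ∃ M : ℝ, ∀ j ∈ Finset.Icc 1 s, ∀ t ∈ Ioc 0 T, ∀ z : Z,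
    ∃ z' : Z, ι z' = phi S (p + j) t (ι z) ∧ t ^ p * ‖z'‖ ≤ M * ‖z‖

end

/-!
The operators `t ^ q φ_q(t G)` are convolutions of the orbit of a semigroup with
`τ ^ (q - 1) / (q - 1)!`, that is, iterated integrals of the orbit (`monomialConv`). So the
derivative of the `(q + 1)`-st one is the `q`-th, and the generator maps the `(q + 1)`-st to the
`q`-th minus `t ^ q / q!` (`IsC0Semigroup.tendsto_generator_monomialConv`). This holds for `A₀` as
well as for `A_{h,0}`.

*Global error.* By definition of the elliptic projection,
`A_h Q_h ∂ x - L_h Q_h ∂ A x = P_h A x - A_{h,0} P_h x + A_{h,0} (P_h - R_h) x`. With the recursion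
for the `φ` functions the first two terms telescope over the powers of `A`, so each term of the
scheme equals the polynomial part of the time step, projected by `P_h`, plus
`k ^ p φ_{p+j}(k A_{h,0}) L_h A ^ p x`, plus terms of size `k ε_h`
(`SpaceDiscretization.V_eq`). The function `W(τ) = L_h y(τ) - y_h(τ)`, where
`y(τ) = τ ^ q φ_q(τ A₀) w` and `y_h(τ) = τ ^ q φ_q(τ A_{h,0}) L_h w`, solves
`W' = A_{h,0} W + A_{h,0} (R_h - P_h) y`, `W(0) = 0`; as `y(τ)` is bounded in `Z`, it has size
`ε_h` (`SpaceDiscretization.norm_L_monomialConv_sub_le`). Consequently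
`e_{h,n+1} = exp (k A_{h,0}) e_{h,n} + P_h ρ_n + O(k ε_h)` (`exists_norm_local_error_le`), and the
errors of at most `T / k` steps add up (`IsC0Semigroup.norm_le_of_recursion`). The local errors lie
in `Z`, and `P_h = L_h - L_h Q_h ∂` is controlled there by the norm, or by the norm and the trace.

*Local error.* The relations `A ^ l f^(r) = A ^ l u^(r+1) - A ^ (l+1) u^(r)` telescope to express
`u^(m)` through `A ^ m u` and the derivatives of `f`. Taylor expansion of `u` and of `A ^ l f` at
`t_n` then leaves exactly the given polynomial in `k` (`sum_taylor_sub_sum_taylor`). Its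
coefficients are multiples of the errors made in the integrals of `(1 - θ) ^ q θ ^ r`, `q + r < p`,
when `θ ^ r` is interpolated at the nodes; exactness of the quadrature rule makes them vanish
(`QuadExact.order_condition`).
-/

/-! ### Convolution with monomials -/

section Convolution

variable {E : Type*} [NormedAddCommGroup E] [NormedSpace ℝ E]

/-- The `q`-fold iterated integral of `h` from `0`, written as the convolution of `h` with
`τ ^ (q - 1) / (q - 1)!` for `q ≥ 1`. For an orbit `h` of a semigroup this is `t ^ q φ_q`. -/
noncomputable def monomialConv (h : ℝ → E) : ℕ → ℝ → E
  | 0, t => h t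
  | q + 1, t => ∫ τ in (0 : ℝ)..t, (τ ^ q / (q ! : ℝ)) • h (t - τ)

lemma monomialConv_succ_eq (h : ℝ → E) (q : ℕ) (t : ℝ) :
    monomialConv h (q + 1) t = ∫ r in (0 : ℝ)..t, ((t - r) ^ q / (q ! : ℝ)) • h r := by
  have := intervalIntegral.integral_comp_sub_left (a := 0) (b := t)
    (fun r => ((t - r) ^ q / (q ! : ℝ)) • h r) t
  simpa [monomialConv] using this

lemma monomialConv_succ_zero (h : ℝ → E) (q : ℕ) : monomialConv h (q + 1) 0 = 0 := by
  simp [monomialConv]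

/-- Integration by parts moves one integration from the kernel onto the function. -/
lemma monomialConv_add_two [CompleteSpace E] {h : ℝ → E} (hh : Continuous h) (q : ℕ) (t : ℝ) :
    monomialConv h (q + 2) t = monomialConv (fun s => ∫ r in (0 : ℝ)..s, h r) (q + 1) t := by
  rw [monomialConv_succ_eq, monomialConv_succ_eq]
  have hu : ∀ r ∈ uIcc 0 t, HasDerivAt (fun r : ℝ => (t - r) ^ (q + 1) / ((q + 1)! : ℝ))
      (-((t - r) ^ q / (q ! : ℝ))) r := by
    intro r _
    have h1 : HasDerivAt (fun r : ℝ => t - r) (-1) r := by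
      simpa using (hasDerivAt_id r).const_sub t
    refine ((h1.pow (q + 1)).div_const ((q + 1)! : ℝ)).congr_deriv ?_
    have : ((q ! : ℝ)) ≠ 0 := by positivity
    rw [Nat.factorial_succ]
    push_cast
    field_simp
  have hv : ∀ r ∈ uIcc 0 t, HasDerivAt (fun s => ∫ r in (0 : ℝ)..s, h r) (h r) r := fun r _ =>
    intervalIntegral.integral_hasDerivAt_right (hh.intervalIntegrable _ _)
      hh.stronglyMeasurable.stronglyMeasurableAtFilter hh.continuousAt
  rw [intervalIntegral.integral_smul_deriv_eq_deriv_smul hu hv]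
  · simp [neg_smul, intervalIntegral.integral_neg]
  · exact (by fun_prop : Continuous fun r : ℝ => -((t - r) ^ q / (q ! : ℝ))).intervalIntegrable _ _
  · exact hh.intervalIntegrable _ _

/-- By induction on `q`, with `h` replaced by its primitive in the induction step. -/
lemma hasDerivAt_monomialConv_succ [CompleteSpace E] {h : ℝ → E} (hh : Continuous h) (q : ℕ)
    (t : ℝ) : HasDerivAt (monomialConv h (q + 1)) (monomialConv h q t) t := by
  have key : ∀ {h : ℝ → E}, Continuous h → ∀ t,
      HasDerivAt (fun s => ∫ r in (0 : ℝ)..s, h r) (h t) t := fun hh t =>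
    intervalIntegral.integral_hasDerivAt_right (hh.intervalIntegrable _ _)
      hh.stronglyMeasurable.stronglyMeasurableAtFilter hh.continuousAt
  have one : ∀ h : ℝ → E, monomialConv h 1 = fun s => ∫ r in (0 : ℝ)..s, h r := fun h => by
    ext s; rw [monomialConv_succ_eq]; simp
  induction q generalizing h with
  | zero => rw [one]; exact key hh t
  | succ q ih =>
    have hH : Continuous fun s => ∫ r in (0 : ℝ)..s, h r :=
      continuous_iff_continuousAt.2 fun s => (key hh s).continuousAt
    rw [show monomialConv h (q + 1 + 1) = _ from funext (monomialConv_add_two hh q)]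
    have := ih hH
    cases q with
    | zero => rw [one h]; exact this
    | succ q => rw [monomialConv_add_two hh]; exact this

end Convolution

/-! ### The operators `φ_q` of a semigroup -/

section Phi

variable {E : Type*} [NormedAddCommGroup E] [NormedSpace ℂ E] {S : ℝ → E →L[ℂ] E}

/-- The orbit `t ↦ S t x`, continued constantly to `t < 0` so as to be continuous on `ℝ`. -/
def semigroupOrbit (S : ℝ → E →L[ℂ] E) (x : E) (t : ℝ) : E := S (max t 0) x

lemma IsC0Semigroup.continuous_orbit (hS : IsC0Semigroup S) (x : E) :
    Continuous (semigroupOrbit S x) :=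
  (hS.cont x).comp_continuous (by fun_prop) fun t => le_max_right t 0

lemma semigroupOrbit_of_nonneg {x : E} {t : ℝ} (ht : 0 ≤ t) : semigroupOrbit S x t = S t x := by
  rw [semigroupOrbit, max_eq_left ht]

lemma pow_smul_phi (x : E) (q : ℕ) {t : ℝ} (ht : 0 < t) :
    t ^ q • phi S q t x = monomialConv (semigroupOrbit S x) q t := by
  cases q with
  | zero => simp [phi, monomialConv, semigroupOrbit_of_nonneg ht.le]
  | succ q =>
    have h1 : t ^ (q + 1) * (1 / t ^ (q + 1)) = 1 := by field_simp
    rw [phi, smul_smul, h1, one_smul, monomialConv]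
    refine intervalIntegral.integral_congr fun τ hτ => ?_
    rw [uIcc_of_le ht.le] at hτ
    rw [semigroupOrbit_of_nonneg (sub_nonneg.2 hτ.2)]

lemma phi_eq_monomialConv (x : E) (q : ℕ) {t : ℝ} (ht : 0 < t) :
    phi S q t x = (1 / t ^ q) • monomialConv (semigroupOrbit S x) q t := by
  rw [← pow_smul_phi x q ht, smul_smul, one_div_mul_cancel (by positivity), one_smul]

lemma norm_monomialConv_orbit_le {M : ℝ} (hM : ∀ t, 0 ≤ t → ∀ x, ‖S t x‖ ≤ M * ‖x‖)
    (x : E) (q : ℕ) {t : ℝ} (ht : 0 ≤ t) :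
    ‖monomialConv (semigroupOrbit S x) q t‖ ≤ M * ‖x‖ * t ^ q := by
  cases q with
  | zero => simpa [monomialConv, semigroupOrbit_of_nonneg ht] using hM t ht x
  | succ q =>
    have : ∀ τ ∈ uIoc 0 t, ‖(τ ^ q / (q ! : ℝ)) • semigroupOrbit S x (t - τ)‖
        ≤ t ^ q * (M * ‖x‖) := by
      intro τ hτ
      rw [uIoc_of_le ht] at hτ
      rw [norm_smul, semigroupOrbit_of_nonneg (sub_nonneg.2 hτ.2)]
      have h0 := hτ.1.le
      have h1 : ‖τ ^ q / (q ! : ℝ)‖ ≤ t ^ q := by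
        rw [Real.norm_of_nonneg (by positivity)]
        refine (div_le_self (by positivity) ?_).trans (pow_le_pow_left₀ h0 hτ.2 q)
        exact_mod_cast Nat.one_le_iff_ne_zero.2 (Nat.factorial_ne_zero q)
      exact mul_le_mul h1 (hM _ (sub_nonneg.2 hτ.2) x) (norm_nonneg _) (by positivity)
    refine (intervalIntegral.norm_integral_le_of_norm_le_const this).trans (le_of_eq ?_)
    rw [sub_zero, abs_of_nonneg ht]
    ring

lemma norm_phi_le {M : ℝ} (hM : ∀ t, 0 ≤ t → ∀ x, ‖S t x‖ ≤ M * ‖x‖)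
    (x : E) (q : ℕ) {t : ℝ} (ht : 0 < t) : ‖phi S q t x‖ ≤ M * ‖x‖ := by
  have h := norm_monomialConv_orbit_le hM x q ht.le
  rw [← pow_smul_phi x q ht, norm_smul, Real.norm_of_nonneg (by positivity), mul_comm] at h
  exact le_of_mul_le_mul_right h (by positivity)

/-- `φ_q(t G)` as a linear map. -/
lemma IsC0Semigroup.exists_linearMap_phi (hS : IsC0Semigroup S) (q : ℕ) {t : ℝ} (ht : 0 < t) :
    ∃ Φ : E →ₗ[ℝ] E, ∀ x, Φ x = phi S q t x := by
  cases q with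
  | zero => exact ⟨(S t).toLinearMap.restrictScalars ℝ, fun x => rfl⟩
  | succ q =>
    have hc : ∀ x, ContinuousOn (fun τ => (τ ^ q / (q ! : ℝ)) • S (t - τ) x) (uIcc 0 t) := by
      intro x
      rw [uIcc_of_le ht.le]
      refine ContinuousOn.smul (M := ℝ) (Continuous.continuousOn
        (by fun_prop : Continuous fun τ : ℝ => τ ^ q / (q ! : ℝ))) ((hS.cont x).comp (by fun_prop) ?_)
      exact fun τ hτ => sub_nonneg.2 hτ.2
    refine ⟨{ toFun := phi S (q + 1) t, map_add' := fun x y => ?_, map_smul' := fun a x => ?_ },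
      fun x => rfl⟩
    · simp only [phi, ← smul_add]
      rw [← intervalIntegral.integral_add (hc x).intervalIntegrable (hc y).intervalIntegrable]
      simp only [map_add, smul_add]
    · simp only [phi, RingHom.id_apply]
      rw [smul_comm a, ← intervalIntegral.integral_smul a]
      refine congrArg _ ?_
      refine intervalIntegral.integral_congr fun τ _ => ?_
      rw [smul_comm a, ContinuousLinearMap.map_smul_of_tower]

/-- The semigroup property under the integral sign. The remainder is an integral over the fixed
interval `[0, 1]`, whose limit as `e → 0` is that of its integrand. -/
lemma IsC0Semigroup.apply_monomialConv [CompleteSpace E] (hS : IsC0Semigroup S) (x : E) (q : ℕ)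
    {t e : ℝ} (ht : 0 ≤ t) (he : 0 ≤ e) :
    S e (monomialConv (semigroupOrbit S x) (q + 1) t) =
      monomialConv (semigroupOrbit S x) (q + 1) (t + e) -
        e • ∫ σ in (0 : ℝ)..1, ((t + e * σ) ^ q / (q ! : ℝ)) • semigroupOrbit S x (e - e * σ) := by
  have hc := hS.continuous_orbit x
  have hci : ∀ b : ℝ, Continuous fun τ : ℝ => (τ ^ q / (q ! : ℝ)) • semigroupOrbit S x (b - τ) :=
    fun b => by fun_prop
  have h1 : S e (monomialConv (semigroupOrbit S x) (q + 1) t) =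
      ∫ τ in (0 : ℝ)..t, (τ ^ q / (q ! : ℝ)) • semigroupOrbit S x (t + e - τ) := by
    rw [monomialConv, ← ContinuousLinearMap.intervalIntegral_comp_comm _
      ((hci t).intervalIntegrable _ _)]
    refine intervalIntegral.integral_congr fun τ hτ => ?_
    rw [uIcc_of_le ht] at hτ
    have h0 := sub_nonneg.2 hτ.2
    rw [ContinuousLinearMap.map_smul_of_tower, semigroupOrbit_of_nonneg h0, semigroupOrbit_of_nonneg (by linarith),
      show t + e - τ = e + (t - τ) by ring, hS.add e _ he h0]
    rfl
  have h2 := intervalIntegral.smul_integral_comp_add_mul (a := 0) (b := 1)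
    (fun τ => (τ ^ q / (q ! : ℝ)) • semigroupOrbit S x (t + e - τ)) e t
  have h3 : ∀ σ : ℝ, t + e - (t + e * σ) = e - e * σ := fun σ => by ring
  simp only [h3, mul_zero, mul_one, add_zero] at h2
  rw [h1, h2, monomialConv, eq_sub_iff_add_eq]
  exact intervalIntegral.integral_add_adjacent_intervals ((hci _).intervalIntegrable _ _)
    ((hci _).intervalIntegrable _ _)

/-- `t ^ (q + 1) φ_{q+1} x` lies in the domain of the generator, which maps it to
`t ^ q φ_q x - t ^ q / q! x`. -/
lemma IsC0Semigroup.tendsto_generator_monomialConv [CompleteSpace E] (hS : IsC0Semigroup S) (x : E)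
    (q : ℕ) {t : ℝ} (ht : 0 ≤ t) :
    Tendsto (fun e : ℝ => (1 / e : ℝ) • (S e (monomialConv (semigroupOrbit S x) (q + 1) t) -
      monomialConv (semigroupOrbit S x) (q + 1) t)) (𝓝[>] 0)
      (𝓝 (monomialConv (semigroupOrbit S x) q t - (t ^ q / (q ! : ℝ)) • x)) := by
  have hc := hS.continuous_orbit x
  set h := semigroupOrbit S x
  have h1 : Tendsto (fun e : ℝ => (1 / e : ℝ) • (monomialConv h (q + 1) (t + e) -
      monomialConv h (q + 1) t)) (𝓝[>] 0) (𝓝 (monomialConv h q t)) := by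
    simpa using (hasDerivAt_monomialConv_succ hc q t).tendsto_slope_zero_right
  have h2 : Tendsto (fun e : ℝ => ∫ σ in (0 : ℝ)..1, ((t + e * σ) ^ q / (q ! : ℝ)) •
      h (e - e * σ)) (𝓝[>] 0) (𝓝 ((t ^ q / (q ! : ℝ)) • x)) := by
    have hcont : Continuous fun e : ℝ => ∫ σ in (0 : ℝ)..1, ((t + e * σ) ^ q / (q ! : ℝ)) •
        h (e - e * σ) := by
      apply intervalIntegral.continuous_parametric_intervalIntegral_of_continuous'
      fun_prop
    have h0 : h 0 = x := by simp [h, semigroupOrbit, hS.zero]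
    have := (hcont.tendsto 0).mono_left (nhdsWithin_le_nhds (s := Ioi 0))
    simpa [h0] using this
  refine (h1.sub h2).congr' ?_
  filter_upwards [self_mem_nhdsWithin] with e he
  have he : 0 < e := he
  rw [hS.apply_monomialConv x q ht he.le, sub_right_comm, smul_sub (1 / e) (_ - _),
    smul_smul (1 / e) e, one_div_mul_cancel he.ne', one_smul]

end Phi

/-! ### Semigroups of bounded generators -/

section Bounded

variable {E : Type*} [NormedAddCommGroup E] [NormedSpace ℂ E] (G : E →L[ℂ] E)

lemma expSemigroup_eq (t : ℝ) : expSemigroup G t = NormedSpace.exp (t • G) := by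
  rw [expSemigroup]; rfl

lemma commute_expSemigroup (t : ℝ) : Commute G (expSemigroup G t) :=
  ((Commute.refl G).smul_right _).exp_right

variable [CompleteSpace E]

lemma hasDerivAt_expSemigroup (t : ℝ) :
    HasDerivAt (expSemigroup G) (expSemigroup G t * G) t := by
  have := hasDerivAt_exp_smul_const (𝕂 := ℝ) G t
  simpa only [← expSemigroup_eq] using this

lemma hasDerivAt_expSemigroup_comp_apply {a : ℝ → ℝ} {a' t : ℝ} (ha : HasDerivAt a a' t)
    {W : ℝ → E} {W' : E} (hW : HasDerivAt W W' t) :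
    HasDerivAt (fun r => expSemigroup G (a r) (W r))
      (a' • expSemigroup G (a t) (G (W t)) + expSemigroup G (a t) W') t := by
  have h1 := (hasDerivAt_expSemigroup G (a t)).scomp t ha
  have h2 := ((ContinuousLinearMap.restrictScalarsL ℂ E E ℝ ℝ).hasFDerivAt.comp_hasDerivAt t h1)
  simpa using h2.clm_apply hW

lemma isC0Semigroup_expSemigroup : IsC0Semigroup (expSemigroup G) where
  zero := by rw [expSemigroup_eq, zero_smul, NormedSpace.exp_zero]; rfl
  add s t _ _ := by
    rw [expSemigroup_eq, expSemigroup_eq, expSemigroup_eq, add_smul]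
    let := NormedAlgebra.restrictScalars ℚ ℂ (E →L[ℂ] E)
    exact NormedSpace.exp_add_of_commute (((Commute.refl G).smul_right t).smul_left s)
  cont x t _ := by
    have := hasDerivAt_expSemigroup_comp_apply G (hasDerivAt_id t) (hasDerivAt_const t x)
    exact this.continuousAt.continuousWithinAt

/-- The generator of the semigroup is `G`, so the general formula for the generator applies. -/
lemma map_monomialConv_succ (x : E) (q : ℕ) {t : ℝ} (ht : 0 ≤ t) :
    G (monomialConv (semigroupOrbit (expSemigroup G) x) (q + 1) t) =
      monomialConv (semigroupOrbit (expSemigroup G) x) q t - (t ^ q / (q ! : ℝ)) • x := by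
  have h1 := (isC0Semigroup_expSemigroup G).tendsto_generator_monomialConv x q ht
  set y := monomialConv (semigroupOrbit (expSemigroup G) x) (q + 1) t
  have h2 : Tendsto (fun e : ℝ => (1 / e : ℝ) • (expSemigroup G e y - y)) (𝓝[>] 0)
      (𝓝 (G y)) := by
    have := hasDerivAt_expSemigroup_comp_apply G (hasDerivAt_id 0) (hasDerivAt_const (0 : ℝ) y)
    simpa [(isC0Semigroup_expSemigroup G).zero] using this.tendsto_slope_zero_right
  exact tendsto_nhds_unique h2 h1

lemma map_monomialConv_comm (x : E) (q : ℕ) (t : ℝ) :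
    monomialConv (semigroupOrbit (expSemigroup G) (G x)) q t =
      G (monomialConv (semigroupOrbit (expSemigroup G) x) q t) := by
  have h : ∀ t, semigroupOrbit (expSemigroup G) (G x) t =
      G (semigroupOrbit (expSemigroup G) x t) := fun t =>
    (congrArg (fun F : E →L[ℂ] E => F x) (commute_expSemigroup G (max t 0)).eq).symm
  have hc := (isC0Semigroup_expSemigroup G).continuous_orbit x
  cases q with
  | zero => exact h t
  | succ q =>
    have hci : Continuous fun τ : ℝ => (τ ^ q / (q ! : ℝ)) •
      semigroupOrbit (expSemigroup G) x (t - τ) := by fun_prop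
    rw [monomialConv, monomialConv, ← ContinuousLinearMap.intervalIntegral_comp_comm _
      (hci.intervalIntegrable _ _)]
    refine intervalIntegral.integral_congr fun τ _ => ?_
    rw [ContinuousLinearMap.map_smul_of_tower, h]

/-- The recursion `z φ_{q+1}(z) = φ_q(z) - 1 / q!` at `z = k G`. -/
lemma smul_phi_succ_map (x : E) (q : ℕ) {k : ℝ} (hk : 0 < k) :
    k • phi (expSemigroup G) (q + 1) k (G x) =
      phi (expSemigroup G) q k x - (1 / (q ! : ℝ)) • x := by
  rw [phi_eq_monomialConv _ _ hk, phi_eq_monomialConv _ _ hk, map_monomialConv_comm,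
    map_monomialConv_succ G x q hk.le, smul_sub, smul_sub, smul_smul, smul_smul, smul_smul]
  congr 2 <;> field_simp <;> ring

/-- Summation of the correction terms of the scheme: the recursion for the `φ` functions makes the
terms in `a` telescope. -/
lemma sum_phi_telescope (j p : ℕ) {k : ℝ} (hk : 0 < k) (a r : ℕ → E) :
    ∑ l ∈ Finset.range p, k ^ (l + 1) • phi (expSemigroup G) (j + l + 1) k
        (a (l + 1) - G (a l) + r l) =
      k ^ p • phi (expSemigroup G) (p + j) k (a p) - phi (expSemigroup G) j k (a 0)
        + ∑ l ∈ Finset.range p, (k ^ l / ((l + j)! : ℝ)) • a l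
        + ∑ l ∈ Finset.range p, k ^ (l + 1) • phi (expSemigroup G) (j + l + 1) k (r l) := by
  induction p with
  | zero => simp
  | succ p ih =>
    obtain ⟨Φ, hΦ⟩ := (isC0Semigroup_expSemigroup G).exists_linearMap_phi (j + p + 1) hk
    have h1 := smul_phi_succ_map G (a p) (j + p) hk
    rw [← hΦ] at h1
    rw [Finset.sum_range_succ, ih, Finset.sum_range_succ, Finset.sum_range_succ, ← hΦ, ← hΦ,
      map_add, map_sub, show p + 1 + j = j + p + 1 by ring, ← hΦ, smul_add, smul_sub,
      pow_succ k p, mul_smul (k ^ p) k (Φ (G (a p))), h1, add_comm p j, smul_sub, smul_smul,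
      mul_one_div]
    abel

end Bounded

/-! ### The boundary operators and the exact problem -/

namespace BoundaryPair

variable {X Y : Type*} [NormedAddCommGroup X] [NormedSpace ℂ X]
  [NormedAddCommGroup Y] [NormedSpace ℂ Y] (B : BoundaryPair X Y)

lemma op_of_mem {x : X} (hx : x ∈ B.dom) : B.op x = B.A ⟨x, hx⟩ := dif_pos hx

lemma trace_of_mem {x : X} (hx : x ∈ B.dom) : B.trace x = B.bd ⟨x, hx⟩ := dif_pos hx

lemma op_sub {x y : X} (hx : x ∈ B.dom) (hy : y ∈ B.dom) :
    B.op (x - y) = B.op x - B.op y := by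
  rw [B.op_of_mem hx, B.op_of_mem hy, B.op_of_mem (B.dom.sub_mem hx hy), ← map_sub]; rfl

lemma trace_smul (a : ℝ) {x : X} (hx : x ∈ B.dom) : B.trace (a • x) = a • B.trace x := by
  rw [B.trace_of_mem hx, B.trace_of_mem (B.dom.smul_of_tower_mem a hx),
    ← LinearMap.map_smul_of_tower]
  rfl

lemma pow_zero (x : X) : B.pow 0 x = x := rfl

lemma pow_succ (l : ℕ) (x : X) : B.pow (l + 1) x = B.op (B.pow l x) :=
  Function.iterate_succ_apply' _ _ _

lemma pow_succ' (l : ℕ) (x : X) : B.pow (l + 1) x = B.pow l (B.op x) := rfl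

variable {B} in
lemma MemDomPow.pow_sub {l : ℕ} {x y : X} (hx : B.MemDomPow l x) (hy : B.MemDomPow l y) :
    B.pow l (x - y) = B.pow l x - B.pow l y := by
  induction l with
  | zero => rfl
  | succ l ih =>
    rw [pow_succ, pow_succ, pow_succ, ih (fun i hi => hx i (by omega))
      (fun i hi => hy i (by omega)), B.op_sub (hx l (by omega)) (hy l (by omega))]

variable {B} in
/-- `A₀` maps `t ^ (q + 1) φ_{q+1}(t A₀) x` to `t ^ q φ_q(t A₀) x - t ^ q / q! x`. -/
lemma Admissible.monomialConv_mem_ker [CompleteSpace X] {S : ℝ → X →L[ℂ] X} (hB : B.Admissible S)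
    (x : X) (q : ℕ) {t : ℝ} (ht : 0 ≤ t) :
    monomialConv (semigroupOrbit S x) (q + 1) t ∈ B.ker ∧
      B.op (monomialConv (semigroupOrbit S x) (q + 1) t) =
        monomialConv (semigroupOrbit S x) q t - (t ^ q / (q ! : ℝ)) • x :=
  (hB.generator _ _).1 (hB.semigroup.tendsto_generator_monomialConv x q ht)

variable {B} in
/-- A semigroup of negative type is bounded. -/
lemma Admissible.exists_norm_le {S : ℝ → X →L[ℂ] X} (hB : B.Admissible S) :
    ∃ M : ℝ, 0 ≤ M ∧ ∀ t, 0 ≤ t → ∀ x, ‖S t x‖ ≤ M * ‖x‖ := by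
  obtain ⟨_, ⟨w, ⟨M, hM⟩, rfl⟩, hw⟩ := sInf_lt_iff.1 hB.type_neg
  have hw0 : w < 0 := by simpa using hw
  have hM0 : 0 ≤ M := by simpa using (norm_nonneg _).trans (hM 0 le_rfl)
  refine ⟨M, hM0, fun t ht x => (S t).le_of_opNorm_le ((hM t ht).trans ?_) x⟩
  exact mul_le_of_le_one_right hM0 (Real.exp_le_one_iff.2 (mul_nonpos_of_nonpos_of_nonneg hw0.le ht))

end BoundaryPair

/-! ### Consistency of the space discretization -/

namespace SpaceDiscretization

variable {X Y Xh : Type*} [NormedAddCommGroup X] [NormedSpace ℂ X]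
  [NormedAddCommGroup Y] [NormedSpace ℂ Y] [NormedAddCommGroup Xh] [NormedSpace ℂ Xh]
  (D : SpaceDiscretization X Y Xh) (B : BoundaryPair X Y)

lemma P_of_trace_eq_zero {x : X} (hx : B.trace x = 0) : D.P B x = D.L x := by
  simp [P, LQ, hx]

lemma A0_R (x : X) : D.A0 (D.R B x) = D.L (B.op x) - D.AQ (B.trace x) := by simp [R]

/-- The boundary correction of the scheme, in terms of `P_h` and the consistency error. -/
lemma AQ_sub_LQ (x : X) : D.AQ (B.trace x) - D.LQ (B.trace (B.op x)) =
    D.P B (B.op x) - D.A0 (D.P B x) + D.A0 (D.P B x - D.R B x) := by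
  rw [map_sub, A0_R, P]
  abel

lemma exists_linearMap_P {Z : Type*} [AddCommGroup Z] [Module ℂ Z] (ι : Z →ₗ[ℂ] X)
    (hι : ∀ z, ι z ∈ B.dom) : ∃ Φ : Z →ₗ[ℂ] D.X0, ∀ z, Φ z = D.P B (ι z) := by
  refine ⟨D.L ∘ₗ ι - D.L ∘ₗ D.emb ∘ₗ D.Q ∘ₗ B.bd ∘ₗ ι.codRestrict B.dom hι, fun z => ?_⟩
  rw [P, LQ, B.trace_of_mem (hι z)]
  rfl

variable [FiniteDimensional ℂ Xh]

/-- The operator `A_{h,0}` as a continuous linear map. -/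
noncomputable def generator : D.X0 →L[ℂ] D.X0 :=
  LinearMap.toContinuousLinearMap (D.A0 : D.X0 →ₗ[ℂ] D.X0)

lemma generator_apply (U : D.X0) : D.generator U = D.A0 U := rfl

lemma semigroup_eq : D.semigroup = expSemigroup D.generator := rfl

/-- The terms of the scheme, rearranged so as to show the same polynomial part as the
time discretization. -/
lemma V_eq {p : ℕ} (hp : 1 ≤ p) (j : ℕ) {k : ℝ} (hk : 0 < k) (x : X) :
    D.V B p j k x = k ^ p • phi D.semigroup (p + j) k (D.L (B.pow p x))
      + ∑ l ∈ Finset.range p, (k ^ l / ((l + j)! : ℝ)) • D.P B (B.pow l x)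
      + ∑ l ∈ Finset.range p, k ^ (l + 1) • phi D.semigroup (j + l + 1) k
          (D.A0 (D.P B (B.pow l x) - D.R B (B.pow l x))) := by
  obtain ⟨p, rfl⟩ := Nat.exists_eq_add_of_le' hp
  have : CompleteSpace D.X0 := FiniteDimensional.complete ℂ D.X0
  have h := sum_phi_telescope D.generator j (p + 1) hk (fun l => D.P B (B.pow l x))
    (fun l => D.A0 (D.P B (B.pow l x) - D.R B (B.pow l x)))
  simp only [← semigroup_eq, generator_apply, B.pow_succ, ← AQ_sub_LQ] at h
  obtain ⟨Φ, hΦ⟩ := (isC0Semigroup_expSemigroup D.generator).exists_linearMap_phi (p + 1 + j) hk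
  simp only [← semigroup_eq] at hΦ
  have h1 : D.AQ (B.trace (B.pow p x)) = (D.AQ (B.trace (B.pow p x)) -
    D.LQ (B.trace (B.op (B.pow p x)))) + D.LQ (B.trace (B.op (B.pow p x))) := by abel
  have h2 : D.L (B.op (B.pow p x)) = D.P B (B.op (B.pow p x)) +
    D.LQ (B.trace (B.op (B.pow p x))) := by rw [P]; abel
  rw [Finset.sum_range_succ, show j + p + 1 = p + 1 + j by ring, ← hΦ, ← hΦ] at h
  rw [V, Nat.add_sub_cancel, ← hΦ, h1, map_add, smul_add, B.pow_succ, ← hΦ, h2, map_add, smul_add]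
  simp only [B.pow_succ, B.pow_zero] at h ⊢
  rw [← sub_eq_zero] at h ⊢
  rw [← h]
  abel

/-- The term `V_{h,n,0}` is of the same form as the others, with `j = 0` and `p + 1` in place of `p`,
up to the propagation of the present error. -/
lemma V0_eq (p : ℕ) (u : ℝ → X) (k t : ℝ) (U : D.X0) :
    D.V0 B p u k t U = D.V B (p + 1) 0 k (u t) - D.semigroup k (D.P B (u t) - U) := by
  have h : Finset.Icc 1 p = (Finset.range p).image (· + 1) := by
    ext i
    simp only [Finset.mem_Icc, Finset.mem_image, Finset.mem_range]
    exact ⟨fun hi => ⟨i - 1, by omega, by omega⟩, by rintro ⟨a, ha, rfl⟩; omega⟩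
  rw [V0, V, h, Finset.sum_image (by simp)]
  simp only [Nat.add_sub_cancel, phi, map_sub, zero_add]
  abel

/-- The discrete evolution follows the exact one up to the consistency error `δ` of `R_h`
along `τ ↦ τ ^ q φ_q(τ A₀) w`, by the variation-of-constants formula. -/
lemma norm_L_monomialConv_sub_le [CompleteSpace X] {S : ℝ → X →L[ℂ] X} (hB : B.Admissible S)
    {C M δ : ℝ} (hL : ∀ x, ‖D.L x‖ ≤ C * ‖x‖)
    (hM : ∀ t : ℝ, 0 ≤ t → ∀ U, ‖D.semigroup t U‖ ≤ M * ‖U‖) (hM0 : 0 ≤ M) (w : X) (q : ℕ)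
    {t : ℝ} (ht : 0 ≤ t)
    (hδ : ∀ τ ∈ Icc 0 t, ‖D.A0 (D.R B (monomialConv (semigroupOrbit S w) (q + 1) τ) -
      D.P B (monomialConv (semigroupOrbit S w) (q + 1) τ))‖ ≤ δ) :
    ‖D.L (monomialConv (semigroupOrbit S w) (q + 1) t) -
      monomialConv (semigroupOrbit D.semigroup (D.L w)) (q + 1) t‖ ≤ M * δ * t := by
  have : CompleteSpace D.X0 := FiniteDimensional.complete ℂ D.X0
  let Lc : X →L[ℂ] D.X0 := D.L.mkContinuous C hL
  set y := monomialConv (semigroupOrbit S w) with hy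
  set yh := monomialConv (semigroupOrbit D.semigroup (D.L w)) with hyh
  -- `W' = A_{h,0} W + r`, and `exp ((t - τ) A_{h,0}) W(τ)` is compared at `τ = 0` and `τ = t`
  let W : ℝ → D.X0 := fun τ => D.L (y (q + 1) τ) - yh (q + 1) τ
  let r : ℝ → D.X0 := fun τ => D.A0 (D.R B (y (q + 1) τ) - D.P B (y (q + 1) τ))
  have hSh := isC0Semigroup_expSemigroup D.generator
  have hW : ∀ τ ∈ Icc 0 t, HasDerivAt W (D.generator (W τ) + r τ) τ := by
    intro τ hτ
    have h1 := hasDerivAt_monomialConv_succ (hB.semigroup.continuous_orbit w) q τ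
    have h2 := hasDerivAt_monomialConv_succ (hSh.continuous_orbit (D.L w)) q τ
    have h3 := ((Lc.restrictScalars ℝ).hasFDerivAt.comp_hasDerivAt τ h1).sub h2
    refine h3.congr_deriv ?_
    obtain ⟨⟨-, h4⟩, h5⟩ := hB.monomialConv_mem_ker w q hτ.1
    have h6 := map_monomialConv_succ D.generator (D.L w) q hτ.1
    have h7 : D.L (B.op (y (q + 1) τ)) = D.L (y q τ) - (τ ^ q / (q ! : ℝ)) • D.L w := by
      rw [h5, map_sub, LinearMap.map_smul_of_tower]
    have h8 := D.A0_R B (y (q + 1) τ)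
    rw [h4, h7, show D.AQ (0 : Y) = 0 by simp [AQ], sub_zero] at h8
    change D.L (y q τ) - yh q τ = D.generator (D.L (y (q + 1) τ) - yh (q + 1) τ) +
      D.A0 (D.R B (y (q + 1) τ) - D.P B (y (q + 1) τ))
    change D.generator (yh (q + 1) τ) = yh q τ - (τ ^ q / (q ! : ℝ)) • D.L w at h6
    rw [map_sub D.A0, h8, D.P_of_trace_eq_zero B h4, map_sub, h6, generator_apply]
    abel
  have hF : ∀ τ ∈ Icc 0 t, HasDerivWithinAt (fun τ => D.semigroup (t - τ) (W τ))
      (D.semigroup (t - τ) (r τ)) (Icc 0 t) τ := by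
    intro τ hτ
    have h1 : HasDerivAt (fun τ : ℝ => t - τ) (-1) τ := by
      simpa using (hasDerivAt_id τ).const_sub t
    refine (hasDerivAt_expSemigroup_comp_apply D.generator h1
      (hW τ hτ)).hasDerivWithinAt.congr_deriv ?_
    rw [map_add, neg_one_smul, semigroup_eq]
    abel
  have hb := norm_image_sub_le_of_norm_deriv_le_segment' hF (C := M * δ) (fun τ hτ =>
    (hM _ (sub_nonneg.2 hτ.2.le) _).trans (mul_le_mul_of_nonneg_left (hδ τ ⟨hτ.1, hτ.2.le⟩) hM0))
    t (right_mem_Icc.2 ht)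
  have hW0 : W 0 = 0 := by
    simp [W, hy, hyh, monomialConv_succ_zero]
  have hS0 : D.semigroup 0 = ContinuousLinearMap.id ℂ D.X0 := hSh.zero
  rw [hW0, map_zero, sub_zero, sub_zero, sub_self, hS0] at hb
  exact hb

end SpaceDiscretization

/-! ### One step of the scheme -/

section Step

variable {X Y Z Xh : Type*} [NormedAddCommGroup X] [NormedSpace ℂ X] [CompleteSpace X]
  [NormedAddCommGroup Y] [NormedSpace ℂ Y] [NormedAddCommGroup Z] [NormedSpace ℂ Z]
  [NormedAddCommGroup Xh] [NormedSpace ℂ Xh] [FiniteDimensional ℂ Xh]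
  {B : BoundaryPair X Y} {S : ℝ → X →L[ℂ] X} {ι : Z →ₗ[ℂ] X} {T : ℝ} {p s : ℕ}
  (D : SpaceDiscretization X Y Xh)

omit [CompleteSpace X] in
/-- A bound on `t ^ p φ_{p+j}(t A₀)` in `Z` gives one on `t ^ (p + j) φ_{p+j}(t A₀)`
that contains the factor `t ^ j`. -/
lemma exists_preimage_monomialConv {M' : ℝ} {j : ℕ} {k : ℝ} (hkT : k ≤ T)
    (hp : 1 ≤ p) (hM' : ∀ t ∈ Ioc 0 T, ∀ z : Z,
      ∃ z' : Z, ι z' = phi S (p + j) t (ι z) ∧ t ^ p * ‖z'‖ ≤ M' * ‖z‖) (hM0 : 0 ≤ M')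
    (z : Z) {τ : ℝ} (hτ : τ ∈ Icc 0 k) :
    ∃ z' : Z, ι z' = monomialConv (semigroupOrbit S (ι z)) (p + j) τ ∧
      ‖z'‖ ≤ M' * ‖z‖ * k ^ j := by
  rcases hτ.1.eq_or_lt with rfl | h0
  · obtain ⟨q, hq⟩ := Nat.exists_eq_add_of_le' (hp.trans (Nat.le_add_right p j))
    refine ⟨0, by rw [hq, monomialConv_succ_zero, map_zero], ?_⟩
    rw [norm_zero]
    have := hτ.2
    positivity
  · obtain ⟨z', h1, h2⟩ := hM' τ ⟨h0, hτ.2.trans hkT⟩ z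
    refine ⟨τ ^ (p + j) • z', ?_, ?_⟩
    · rw [LinearMap.map_smul_of_tower, h1, pow_smul_phi _ _ h0]
    · rw [norm_smul, Real.norm_of_nonneg (by positivity), pow_add, mul_right_comm]
      exact mul_le_mul h2 (pow_le_pow_left₀ h0.le hτ.2 j) (by positivity) (by positivity)

/-- Consistency of `φ_{p+j}(k A_{h,0}) L_h` with `P_h φ_{p+j}(k A₀)` on `Z`. -/
lemma norm_P_phi_sub_le (hB : B.Admissible S) {C M M' ε : ℝ} {j : ℕ} {k : ℝ} (hk : 0 < k)
    (hkT : k ≤ T) (hp : 1 ≤ p) (hL : ∀ x, ‖D.L x‖ ≤ C * ‖x‖)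
    (hM : ∀ t : ℝ, 0 ≤ t → ∀ U, ‖D.semigroup t U‖ ≤ M * ‖U‖) (hM0 : 0 ≤ M) (hε : 0 ≤ ε)
    (hcons : ∀ z, ‖D.A0 (D.R B (ι z) - D.P B (ι z))‖ ≤ ε * ‖z‖)
    (hM' : ∀ t ∈ Ioc 0 T, ∀ z : Z,
      ∃ z' : Z, ι z' = phi S (p + j) t (ι z) ∧ t ^ p * ‖z'‖ ≤ M' * ‖z‖) (hM0' : 0 ≤ M') (z : Z) :
    ‖k ^ p • (D.P B (phi S (p + j) k (ι z)) - phi D.semigroup (p + j) k (D.L (ι z)))‖ ≤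
      M * ε * M' * ‖z‖ * k := by
  have hδ : ∀ τ ∈ Icc 0 k, ‖D.A0 (D.R B (monomialConv (semigroupOrbit S (ι z)) (p + j) τ) -
      D.P B (monomialConv (semigroupOrbit S (ι z)) (p + j) τ))‖ ≤ ε * (M' * ‖z‖ * k ^ j) := by
    intro τ hτ
    obtain ⟨z', h1, h2⟩ := exists_preimage_monomialConv hkT hp hM' hM0' z hτ
    rw [← h1]
    exact (hcons z').trans (mul_le_mul_of_nonneg_left h2 hε)
  obtain ⟨q, hq⟩ := Nat.exists_eq_add_of_le' (hp.trans (Nat.le_add_right p j))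
  have h3 := D.norm_L_monomialConv_sub_le B hB hL hM hM0 (ι z) q hk.le (hq ▸ hδ)
  rw [← hq, ← pow_smul_phi _ _ hk, ← pow_smul_phi _ _ hk, LinearMap.map_smul_of_tower,
    ← smul_sub, pow_add, mul_comm (k ^ p), mul_smul, norm_smul,
    Real.norm_of_nonneg (by positivity)] at h3
  have h4 : B.trace (phi S (p + j) k (ι z)) = 0 := by
    obtain ⟨h5, h6⟩ := (hB.monomialConv_mem_ker (ι z) q hk.le).1
    rw [phi_eq_monomialConv _ _ hk, hq, B.trace_smul _ h5, h6, smul_zero]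
  rw [D.P_of_trace_eq_zero B h4]
  refine le_of_mul_le_mul_left (h3.trans (le_of_eq ?_)) (pow_pos hk j)
  ring

omit [CompleteSpace X] in
/-- Consistency error of one term of the scheme, given that of its last `φ` function. -/
lemma norm_P_sum_sub_V_le {M N ε η : ℝ} {j : ℕ} {k : ℝ} (hk : 0 < k) (hkT : k ≤ T) (hp : 1 ≤ p)
    (hM : ∀ t : ℝ, 0 ≤ t → ∀ U, ‖D.semigroup t U‖ ≤ M * ‖U‖) (hM0 : 0 ≤ M) (hε : 0 ≤ ε)
    (hcons : ∀ z, ‖D.A0 (D.R B (ι z) - D.P B (ι z))‖ ≤ ε * ‖z‖) {x : X}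
    (hx : ∀ l < p, ∃ z, ι z = B.pow l x ∧ ‖z‖ ≤ N)
    (hη : ‖k ^ p • (D.P B (phi S (p + j) k (B.pow p x)) -
      phi D.semigroup (p + j) k (D.L (B.pow p x)))‖ ≤ η) :
    ‖∑ l ∈ Finset.range p, (k ^ l / ((l + j)! : ℝ)) • D.P B (B.pow l x)
      + k ^ p • D.P B (phi S (p + j) k (B.pow p x)) - D.V B p j k x‖ ≤
      η + k * (M * ε * N * ∑ l ∈ Finset.range p, T ^ l) := by
  have h1 : ∑ l ∈ Finset.range p, (k ^ l / ((l + j)! : ℝ)) • D.P B (B.pow l x)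
      + k ^ p • D.P B (phi S (p + j) k (B.pow p x)) - D.V B p j k x =
      k ^ p • (D.P B (phi S (p + j) k (B.pow p x)) -
        phi D.semigroup (p + j) k (D.L (B.pow p x))) -
      ∑ l ∈ Finset.range p, k ^ (l + 1) • phi D.semigroup (j + l + 1) k
          (D.A0 (D.P B (B.pow l x) - D.R B (B.pow l x))) := by
    rw [D.V_eq B hp j hk x, smul_sub]
    abel
  rw [h1]
  refine (norm_sub_le _ _).trans (add_le_add hη ((norm_sum_le _ _).trans ?_))
  rw [Finset.mul_sum, Finset.mul_sum]
  refine Finset.sum_le_sum fun l hl => ?_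
  obtain ⟨z, hz, hN⟩ := hx l (Finset.mem_range.1 hl)
  have h2 : ‖D.A0 (D.P B (B.pow l x) - D.R B (B.pow l x))‖ ≤ ε * N := by
    rw [← hz, ← neg_sub, map_neg, norm_neg]
    exact (hcons z).trans (mul_le_mul_of_nonneg_left hN hε)
  have hN0 : 0 ≤ N := (norm_nonneg _).trans hN
  rw [norm_smul, Real.norm_of_nonneg (by positivity), pow_succ']
  calc k * k ^ l * _ ≤ k * T ^ l * (M * (ε * N)) := by
        refine mul_le_mul ?_ ((norm_phi_le hM _ _ hk).trans (mul_le_mul_of_nonneg_left h2 hM0))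
          (norm_nonneg _) (mul_nonneg hk.le (pow_nonneg (hk.le.trans hkT) _))
        exact mul_le_mul_of_nonneg_left (pow_le_pow_left₀ hk.le hkT l) hk.le
    _ = _ := by ring

/-- The time step takes place in `Z`, and `P_h` maps it to the fully discrete step up to `k ε_h`. -/
lemma norm_P_timeStep_sub_le (hB : B.Admissible S) {C M M' N ε : ℝ} {k : ℝ} (hk : 0 < k)
    (hkT : k ≤ T) (hp : 1 ≤ p) (hs : 1 ≤ s) (c : Fin s → ℝ) (hL : ∀ x, ‖D.L x‖ ≤ C * ‖x‖)
    (hM : ∀ t : ℝ, 0 ≤ t → ∀ U, ‖D.semigroup t U‖ ≤ M * ‖U‖) (hM0 : 0 ≤ M) (hε : 0 ≤ ε)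
    (hcons : ∀ z, ‖D.A0 (D.R B (ι z) - D.P B (ι z))‖ ≤ ε * ‖z‖)
    (hι : ∀ z, ι z ∈ B.dom)
    (hM' : ∀ j ∈ Finset.Icc 1 s, ∀ t ∈ Ioc 0 T, ∀ z : Z,
      ∃ z' : Z, ι z' = phi S (p + j) t (ι z) ∧ t ^ p * ‖z'‖ ≤ M' * ‖z‖) (hM0' : 0 ≤ M')
    (f u : ℝ → X) (t : ℝ) (hN0 : 0 ≤ N)
    (hu : ∀ l ≤ p + 1, ∃ z, ι z = B.pow l (u t) ∧ ‖z‖ ≤ N)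
    (hf : ∀ i, ∀ l ≤ p, ∃ z, ι z = B.pow l (f (t + c i * k)) ∧ ‖z‖ ≤ N) (U : D.X0) :
    (∃ z, ι z = timeStep B S p c f k t (u t)) ∧
    ‖D.P B (timeStep B S p c f k t (u t)) - (D.V0 B p u k t U
      + k • ∑ i : Fin s, ∑ j : Fin s, quadCoeff c i j • D.V B p (j + 1) k (f (t + c i * k)))
      - D.semigroup k (D.P B (u t) - U)‖ ≤
      k * ε * (M * N * (M' * T + ∑ l ∈ Finset.range (p + 1), T ^ l) +
        T * (∑ i : Fin s, ∑ j : Fin s, |quadCoeff c i j|) *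
          (M * N * (M' + ∑ l ∈ Finset.range p, T ^ l))) := by
  have hT : 0 ≤ T := hk.le.trans hkT
  have hjs : ∀ j : Fin s, (j : ℕ) + 1 ∈ Finset.Icc 1 s := fun j =>
    Finset.mem_Icc.2 ⟨by omega, by omega⟩
  have h1s : 1 ∈ Finset.Icc 1 s := Finset.mem_Icc.2 ⟨le_rfl, hs⟩
  choose zu hzu hzuN using hu
  choose zf hzf hzfN using hf
  obtain ⟨zp, hzp, -⟩ := hM' 1 h1s k ⟨hk, hkT⟩ (zu (p + 1) le_rfl)
  choose zq hzq _ using fun i (j : Fin s) => hM' _ (hjs j) k ⟨hk, hkT⟩ (zf i p le_rfl)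
  obtain ⟨Φ, hΦ⟩ := D.exists_linearMap_P B ι hι
  -- the preimage of the time step in `Z`
  let zs : Z := ∑ l : Fin (p + 1), (k ^ (l : ℕ) / ((l : ℕ)! : ℝ)) • zu l (by omega)
    + k ^ (p + 1) • zp
    + k • ∑ i : Fin s, ∑ j : Fin s, quadCoeff c i j •
      (∑ l : Fin p, (k ^ (l : ℕ) / (((l : ℕ) + (j + 1))! : ℝ)) • zf i l (by omega)
        + k ^ p • zq i j)
  have hzs : ι zs = timeStep B S p c f k t (u t) := by
    simp only [zs, timeStep, map_add, map_sum, LinearMap.map_smul_of_tower, hzp, hzq, hzu, hzf,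
      Finset.sum_range]
  have hPz : ∀ z, D.P B (ι z) = Φ z := fun z => (hΦ z).symm
  have hPs : D.P B (timeStep B S p c f k t (u t)) =
      (∑ l ∈ Finset.range (p + 1), (k ^ l / ((l + 0)! : ℝ)) • D.P B (B.pow l (u t))
        + k ^ (p + 1) • D.P B (phi S (p + 1 + 0) k (B.pow (p + 1) (u t))))
      + k • ∑ i : Fin s, ∑ j : Fin s, quadCoeff c i j •
        (∑ l ∈ Finset.range p, (k ^ l / ((l + (j + 1))! : ℝ)) • D.P B (B.pow l (f (t + c i * k)))
          + k ^ p • D.P B (phi S (p + (j + 1)) k (B.pow p (f (t + c i * k))))) := by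
    rw [← hzs, hPz]
    simp only [Finset.sum_range, add_zero, ← hzu _ (Nat.lt_succ_iff.1 (Fin.is_lt _) |>.trans
      (Nat.le_succ p)), ← hzf _ _ (Fin.is_lt _).le, ← hzf _ p le_rfl, ← hzu _ le_rfl, ← hzp, ← hzq,
      hPz, zs, map_add, map_sum, LinearMap.map_smul_of_tower]
  refine ⟨⟨zs, hzs⟩, ?_⟩
  have hu' : ‖∑ l ∈ Finset.range (p + 1), (k ^ l / ((l + 0)! : ℝ)) • D.P B (B.pow l (u t))
      + k ^ (p + 1) • D.P B (phi S (p + 1 + 0) k (B.pow (p + 1) (u t)))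
      - D.V B (p + 1) 0 k (u t)‖ ≤
      k * (M * ε * M' * N * T) + k * (M * ε * N * ∑ l ∈ Finset.range (p + 1), T ^ l) := by
    refine norm_P_sum_sub_V_le D hk hkT (by omega) hM hM0 hε hcons
      (fun l hl => ⟨zu l (by omega), hzu _ _, hzuN _ _⟩) ?_
    have := norm_P_phi_sub_le D hB hk hkT hp hL hM hM0 hε hcons (hM' 1 h1s) hM0'
      (zu (p + 1) le_rfl)
    rw [add_zero, pow_succ', mul_smul, norm_smul, Real.norm_of_nonneg hk.le, ← hzu _ le_rfl]
    refine mul_le_mul_of_nonneg_left (this.trans ?_) hk.le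
    refine mul_le_mul (mul_le_mul_of_nonneg_left (hzuN _ _) (by positivity)) hkT hk.le
      (by positivity)
  have hf' : ∀ i (j : Fin s), ‖∑ l ∈ Finset.range p, (k ^ l / ((l + (j + 1))! : ℝ)) •
        D.P B (B.pow l (f (t + c i * k)))
      + k ^ p • D.P B (phi S (p + (j + 1)) k (B.pow p (f (t + c i * k))))
      - D.V B p (j + 1) k (f (t + c i * k))‖ ≤
      M * ε * M' * N * k + k * (M * ε * N * ∑ l ∈ Finset.range p, T ^ l) := by
    intro i j
    refine norm_P_sum_sub_V_le D hk hkT hp hM hM0 hε hcons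
      (fun l hl => ⟨zf i l hl.le, hzf _ _ _, hzfN _ _ _⟩) ?_
    have := norm_P_phi_sub_le D hB hk hkT hp hL hM hM0 hε hcons (hM' _ (hjs j)) hM0'
      (zf i p le_rfl)
    rw [hzf] at this
    refine this.trans ?_
    exact mul_le_mul_of_nonneg_right (mul_le_mul_of_nonneg_left (hzfN _ _ _) (by positivity)) hk.le
  rw [hPs, D.V0_eq]
  generalize (∑ l ∈ Finset.range (p + 1), (k ^ l / ((l + 0)! : ℝ)) • D.P B (B.pow l (u t))
      + k ^ (p + 1) • D.P B (phi S (p + 1 + 0) k (B.pow (p + 1) (u t)))) = a at hu' ⊢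
  set b : Fin s → Fin s → D.X0 := fun i j =>
    (∑ l ∈ Finset.range p, (k ^ l / ((l + (j + 1))! : ℝ)) • D.P B (B.pow l (f (t + c i * k)))
          + k ^ p • D.P B (phi S (p + (j + 1)) k (B.pow p (f (t + c i * k)))))
  have hsplit : a + k • ∑ i : Fin s, ∑ j : Fin s, quadCoeff c i j • b i j -
      (D.V B (p + 1) 0 k (u t) - D.semigroup k (D.P B (u t) - U) +
        k • ∑ i : Fin s, ∑ j : Fin s, quadCoeff c i j • D.V B p (j + 1) k (f (t + c i * k))) -
      D.semigroup k (D.P B (u t) - U) = (a - D.V B (p + 1) 0 k (u t)) +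
        k • ∑ i : Fin s, ∑ j : Fin s, quadCoeff c i j •
          (b i j - D.V B p (j + 1) k (f (t + c i * k))) := by
    simp only [smul_sub, Finset.sum_sub_distrib]
    abel
  rw [hsplit]
  have hsum : ‖∑ i : Fin s, ∑ j : Fin s, quadCoeff c i j •
      (b i j - D.V B p (j + 1) k (f (t + c i * k)))‖ ≤
      (∑ i : Fin s, ∑ j : Fin s, |quadCoeff c i j|) *
        (M * ε * M' * N * k + k * (M * ε * N * ∑ l ∈ Finset.range p, T ^ l)) := by
    simp only [Finset.sum_mul]
    refine norm_sum_le_of_le _ fun i _ => norm_sum_le_of_le _ fun j _ => ?_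
    rw [norm_smul, Real.norm_eq_abs]
    exact mul_le_mul_of_nonneg_left (hf' i j) (abs_nonneg _)
  refine (norm_add_le _ _).trans ((add_le_add hu' ((norm_smul_le _ _).trans
    (mul_le_mul (Real.norm_of_nonneg hk.le).le hsum (norm_nonneg _) hk.le))).trans ?_)
  set a₁ := ∑ i : Fin s, ∑ j : Fin s, |quadCoeff c i j|
  have ha₁ : 0 ≤ a₁ := Finset.sum_nonneg fun i _ => Finset.sum_nonneg fun j _ => abs_nonneg _
  have ht : 0 ≤ ∑ l ∈ Finset.range p, T ^ l := Finset.sum_nonneg fun l _ => pow_nonneg hT l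
  have h0 : k * (k * ε * a₁ * (M * N * (M' + ∑ l ∈ Finset.range p, T ^ l))) ≤
      k * (T * ε * a₁ * (M * N * (M' + ∑ l ∈ Finset.range p, T ^ l))) := by gcongr
  calc _ = k * ε * (M * N * (M' * T + ∑ l ∈ Finset.range (p + 1), T ^ l)) +
        k * (k * ε * a₁ * (M * N * (M' + ∑ l ∈ Finset.range p, T ^ l))) := by ring
    _ ≤ _ := add_le_add_right h0 _
    _ = _ := by ring

end Step

/-! ### The global error -/

/-- Accumulation of local errors under a bounded semigroup. -/
lemma IsC0Semigroup.norm_le_of_recursion {E : Type*} [NormedAddCommGroup E] [NormedSpace ℂ E]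
    {S : ℝ → E →L[ℂ] E} (hS : IsC0Semigroup S) {M b k : ℝ}
    (hM : ∀ t : ℝ, 0 ≤ t → ∀ U, ‖S t U‖ ≤ M * ‖U‖) (hM0 : 0 ≤ M) (hk : 0 ≤ k) {e : ℕ → E}
    (he : e 0 = 0) {N : ℕ} (hd : ∀ n < N, ‖e (n + 1) - S k (e n)‖ ≤ b) :
    ‖e N‖ ≤ N * (M * b) := by
  -- `S` is only bounded, not contractive: the induction bounds the whole forward orbit of `e n`
  have key : ∀ n ≤ N, ∀ t : ℝ, 0 ≤ t → ‖S t (e n)‖ ≤ n * (M * b) := by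
    intro n
    induction n with
    | zero => intro _ t _; simp [he]
    | succ n ih =>
      intro hn t ht
      have h1 : S t (e (n + 1)) = S (t + k) (e n) + S t (e (n + 1) - S k (e n)) := by
        rw [hS.add t k ht hk, map_sub, ContinuousLinearMap.comp_apply]
        abel
      rw [h1]
      refine (norm_add_le _ _).trans ((add_le_add (ih (by omega) _ (by positivity))
        ((hM t ht _).trans (mul_le_mul_of_nonneg_left (hd n (by omega)) hM0))).trans (le_of_eq ?_))
      push_cast
      ring
  simpa [hS.zero] using key N le_rfl 0 le_rfl

lemma ContinuousInto.exists_bound {X Z : Type*} [NormedAddCommGroup X] [NormedSpace ℂ X]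
    [NormedAddCommGroup Z] [NormedSpace ℂ Z] {ι : Z →ₗ[ℂ] X} {T : ℝ} {p : ℕ} {v : ℕ → ℝ → X}
    (hv : ∀ l ≤ p, ContinuousInto ι T (v l)) :
    ∃ N : ℝ, 0 ≤ N ∧ ∀ l ≤ p, ∀ t ∈ Icc 0 T, ∃ z, ι z = v l t ∧ ‖z‖ ≤ N := by
  have h1 : ∀ l, ∃ N : ℝ, 0 ≤ N ∧ (l ≤ p → ∀ t ∈ Icc 0 T, ∃ z, ι z = v l t ∧ ‖z‖ ≤ N) := by
    intro l
    by_cases hl : l ≤ p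
    · obtain ⟨w, hw, hwv⟩ := hv l hl
      obtain ⟨N, hN⟩ := isCompact_Icc.exists_bound_of_continuousOn hw
      exact ⟨max N 0, le_max_right _ _,
        fun _ t ht => ⟨w t, hwv t ht, (hN t ht).trans (le_max_left _ _)⟩⟩
    · exact ⟨0, le_rfl, fun h => absurd h hl⟩
  choose N hN0 hN using h1
  refine ⟨∑ l ∈ Finset.range (p + 1), N l, Finset.sum_nonneg fun l _ => hN0 l,
    fun l hl t ht => ?_⟩
  obtain ⟨z, hz, hzN⟩ := hN l hl t ht
  exact ⟨z, hz, hzN.trans (Finset.single_le_sum (fun l _ => hN0 l)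
    (Finset.mem_range.2 (Nat.lt_succ_of_le hl)))⟩

section GlobalError

variable {X Y Z : Type*} [NormedAddCommGroup X] [NormedSpace ℂ X] [CompleteSpace X]
  [NormedAddCommGroup Y] [NormedSpace ℂ Y] [NormedAddCommGroup Z] [NormedSpace ℂ Z]
  {B : BoundaryPair X Y} {S : ℝ → X →L[ℂ] X} {ι : Z →ₗ[ℂ] X} {T : ℝ} {p s : ℕ}
  {Xh : ℕ → Type*} [∀ m, NormedAddCommGroup (Xh m)] [∀ m, NormedSpace ℂ (Xh m)]
  [∀ m, FiniteDimensional ℂ (Xh m)] {D : ∀ m, SpaceDiscretization X Y (Xh m)} {h ε : ℕ → ℝ}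

/-- The fully discrete local errors: `P_h` of the local errors of the time discretization, up to
`k ε_h`. -/
lemma exists_norm_local_error_le (hB : B.Admissible S) (hp : 1 ≤ p) (hs : 1 ≤ s) {c : Fin s → ℝ}
    (hc01 : ∀ i, c i ∈ Icc (0 : ℝ) 1) {u₀ : X} {f u : ℝ → X}
    (hZ : SmoothSubspace B S ι T p s)
    (huZ : ∀ j ≤ p + 1, ContinuousInto ι T (fun t => B.pow j (u t)))
    (hfZ : ∀ j ≤ p, ContinuousInto ι T (fun t => B.pow j (f t)))
    (hD : DiscretizationFamily B ι D h ε) :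
    ∃ K : ℝ, 0 ≤ K ∧ ∀ m n : ℕ, ∀ k : ℝ, 0 < k → ((n + 1 : ℕ) : ℝ) * k ≤ T →
      (∃ z, ι z = timeLocalError B S p c f u k n) ∧
      ‖((D m).P B (u (((n + 1 : ℕ) : ℝ) * k)) - (D m).scheme B p c u₀ f u k (n + 1)) -
        (D m).semigroup k ((D m).P B (u (n * k)) - (D m).scheme B p c u₀ f u k n)‖ ≤
      ‖(D m).P B (timeLocalError B S p c f u k n)‖ + k * K * ε m := by
  obtain ⟨M₀, hM₀⟩ := hD.stable
  obtain ⟨M', hM'⟩ := hZ.phi_bound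
  obtain ⟨C, hC⟩ := hD.L_bound
  obtain ⟨N₁, hN₁, hu⟩ := ContinuousInto.exists_bound huZ
  obtain ⟨N₂, hN₂, hf⟩ := ContinuousInto.exists_bound hfZ
  by_cases hT : 0 < T
  swap
  · refine ⟨0, le_rfl, fun m n k hk hnk => absurd (lt_of_lt_of_le ?_ hnk) hT⟩
    positivity
  have hM0 : 0 ≤ max M₀ 0 := le_max_right _ _
  have hM0' : 0 ≤ max M' 0 := le_max_right _ _
  have hN0 : 0 ≤ max N₁ N₂ := hN₁.trans (le_max_left _ _)
  refine ⟨max M₀ 0 * max N₁ N₂ * (max M' 0 * T + ∑ l ∈ Finset.range (p + 1), T ^ l) +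
    T * (∑ i : Fin s, ∑ j : Fin s, |quadCoeff c i j|) *
      (max M₀ 0 * max N₁ N₂ * (max M' 0 + ∑ l ∈ Finset.range p, T ^ l)),
    by positivity, fun m n k hk hnk => ?_⟩
  · have hnk' : n * k + k ≤ T := by push_cast at hnk; linarith
    have hn0 : 0 ≤ n * k := by positivity
    have hkT : k ≤ T := by linarith
    obtain ⟨⟨z, hz⟩, hle⟩ := norm_P_timeStep_sub_le (ι := ι) (M := max M₀ 0) (M' := max M' 0)
      (N := max N₁ N₂) (D m) hB hk hkT hp hs c
      (hC m) (fun t ht U => (hM₀ m t ht U).trans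
        (mul_le_mul_of_nonneg_right (le_max_left _ _) (norm_nonneg _)))
      hM0 (hD.ε_nonneg m) (hD.consistent m) hZ.le_dom
      (fun j hj t ht z => (hM' j hj t ht z).imp fun z' hz' => ⟨hz'.1, hz'.2.trans
        (mul_le_mul_of_nonneg_right (le_max_left _ _) (norm_nonneg _))⟩)
      hM0' f u (n * k) hN0
      (fun l hl => (hu l hl (n * k) ⟨hn0, by linarith⟩).imp fun z hz =>
        ⟨hz.1, hz.2.trans (le_max_left _ _)⟩)
      (fun i l hl => (hf l hl (n * k + c i * k) ⟨by have := (hc01 i).1; positivity, by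
        nlinarith [(hc01 i).2]⟩).imp fun z hz => ⟨hz.1, hz.2.trans (le_max_right _ _)⟩)
      ((D m).scheme B p c u₀ f u k n)
    obtain ⟨z₁, hz₁, -⟩ := hu 0 (Nat.zero_le _) (((n + 1 : ℕ) : ℝ) * k) ⟨by positivity, hnk⟩
    change ι z₁ = u _ at hz₁
    obtain ⟨Φ, hΦ⟩ := (D m).exists_linearMap_P B ι hZ.le_dom
    have hρ : timeLocalError B S p c f u k n = ι (z₁ - z) := by
      rw [timeLocalError, map_sub, hz, hz₁]
    refine ⟨⟨z₁ - z, hρ.symm⟩, ?_⟩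
    have hP : (D m).P B (u (((n + 1 : ℕ) : ℝ) * k)) =
        (D m).P B (timeLocalError B S p c f u k n) +
          (D m).P B (timeStep B S p c f k (n * k) (u (n * k))) := by
      rw [hρ, ← hz₁, ← hz, ← hΦ, ← hΦ, ← hΦ, ← map_add, sub_add_cancel]
    rw [hP, add_sub_assoc, add_sub_assoc]
    refine (norm_add_le _ _).trans (add_le_add le_rfl (hle.trans (le_of_eq ?_)))
    exact mul_right_comm _ _ _

/-- The global error bound, for any size `ν` of local errors that controls `P_h`. -/
lemma exists_norm_error_le (hB : B.Admissible S) (hT : 0 < T) (hp : 1 ≤ p) (hs : 1 ≤ s)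
    {c : Fin s → ℝ} (hc01 : ∀ i, c i ∈ Icc (0 : ℝ) 1) {u₀ : X} {f u : ℝ → X} (hu0 : u 0 = u₀)
    (hZ : SmoothSubspace B S ι T p s)
    (huZ : ∀ j ≤ p + 1, ContinuousInto ι T (fun t => B.pow j (u t)))
    (hfZ : ∀ j ≤ p, ContinuousInto ι T (fun t => B.pow j (f t)))
    (hD : DiscretizationFamily B ι D h ε) (ν : X → ℝ) (hν : ∀ x, 0 ≤ ν x)
    (hP : ∃ C : ℝ, ∀ m, ∀ z : Z, ‖(D m).P B (ι z)‖ ≤ C * ν (ι z)) :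
    ∃ C : ℝ, ∀ m n : ℕ, ∀ k : ℝ, 0 < k → n * k ≤ T →
      ‖(D m).P B (u (n * k)) - (D m).scheme B p c u₀ f u k n‖ ≤
        C * (1 / k * (⨆ l : Fin n, ν (timeLocalError B S p c f u k l)) + ε m) := by
  obtain ⟨M₀, hM₀⟩ := hD.stable
  obtain ⟨K, hK0, hK⟩ := exists_norm_local_error_le (u₀ := u₀) hB hp hs hc01 hZ huZ hfZ hD
  obtain ⟨C, hC⟩ := hP
  have hM0 : 0 ≤ max M₀ 0 := le_max_right _ _
  have hC0 : 0 ≤ max C 0 := le_max_right _ _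
  set M := max M₀ 0
  refine ⟨T * M * (max C 0 + K), fun m n k hk hnk => ?_⟩
  have : CompleteSpace (D m).X0 := FiniteDimensional.complete ℂ (D m).X0
  set r := ⨆ l : Fin n, ν (timeLocalError B S p c f u k l) with hr
  have hr0 : 0 ≤ r := Real.iSup_nonneg fun l => hν _
  have hε := hD.ε_nonneg m
  have hle := (isC0Semigroup_expSemigroup (D m).generator).norm_le_of_recursion
    (e := fun n => (D m).P B (u (n * k)) - (D m).scheme B p c u₀ f u k n) (M := M) (N := n)
    (b := max C 0 * r + k * K * ε m)
    (fun t ht U => (hM₀ m t ht U).trans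
        (mul_le_mul_of_nonneg_right (le_max_left _ _) (norm_nonneg _))) hM0 hk.le
    (by simp [SpaceDiscretization.scheme, hu0]) (fun l hl => ?_)
  · refine hle.trans ?_
    calc n * (M * (max C 0 * r + k * K * ε m))
        = n * k * (M * (max C 0 * (1 / k * r) + K * ε m)) := by field_simp
      _ ≤ T * (M * ((max C 0 + K) * (1 / k * r) + (max C 0 + K) * ε m)) := by
        gcongr
        · linarith
        · linarith
      _ = _ := by ring
  · obtain ⟨⟨z, hz⟩, h1⟩ := hK m l k hk
      (le_trans (mul_le_mul_of_nonneg_right (by exact_mod_cast hl) hk.le) hnk)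
    refine h1.trans (add_le_add ?_ le_rfl)
    rw [← hz]
    refine (hC m z).trans (mul_le_mul (le_max_left _ _) ?_ (hν _) hC0)
    rw [hz]
    exact le_ciSup (f := fun l : Fin n => ν (timeLocalError B S p c f u k l))
      (Set.finite_range _).bddAbove ⟨l, hl⟩

omit [CompleteSpace X] in
lemma DiscretizationFamily.exists_norm_P_le (hD : DiscretizationFamily B ι D h ε) :
    ∃ C : ℝ, ∀ m, ∀ x : X, ‖(D m).P B x‖ ≤ C * (‖x‖ + ‖B.trace x‖) := by
  obtain ⟨C₁, h₁⟩ := hD.L_bound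
  obtain ⟨C₂, h₂⟩ := hD.LQ_bound
  refine ⟨max C₁ C₂, fun m x => (norm_sub_le _ _).trans ?_⟩
  rw [mul_add]
  exact add_le_add
    ((h₁ m x).trans (mul_le_mul_of_nonneg_right (le_max_left _ _) (norm_nonneg _)))
    ((h₂ m _).trans (mul_le_mul_of_nonneg_right (le_max_right _ _) (norm_nonneg _)))

end GlobalError

/-! ### Exactness of the quadrature rule and the order conditions -/

/-- The convolution of two normalized monomials is a normalized monomial (a Beta integral). -/
lemma monomialConv_pow (q j : ℕ) (t : ℝ) :
    monomialConv (fun r : ℝ => r ^ q / (q ! : ℝ)) (j + 1) t =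
      t ^ (q + j + 1) / ((q + j + 1)! : ℝ) := by
  induction j generalizing q with
  | zero =>
    have : ((q ! : ℝ)) ≠ 0 := by positivity
    rw [monomialConv_succ_eq]
    simp [Nat.factorial_succ]
    field_simp
  | succ j ih =>
    rw [monomialConv_add_two (by fun_prop)]
    have h : (fun s : ℝ => ∫ r in (0 : ℝ)..s, r ^ q / (q ! : ℝ)) =
        fun s => s ^ (q + 1) / ((q + 1)! : ℝ) := by
      ext s
      have : ((q ! : ℝ)) ≠ 0 := by positivity
      simp [Nat.factorial_succ]
      field_simp
    rw [h, ih, show q + 1 + j + 1 = q + (j + 1) + 1 by ring]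

lemma integral_one_sub_pow_mul_pow (q j : ℕ) :
    ∫ θ in (0 : ℝ)..1, (1 - θ) ^ q / (q ! : ℝ) * (θ ^ j / (j ! : ℝ)) =
      1 / ((q + j + 1)! : ℝ) := by
  have h := monomialConv_pow q j 1
  rw [one_pow] at h
  rw [← h, monomialConv]
  refine intervalIntegral.integral_congr fun θ _ => ?_
  rw [smul_eq_mul, mul_comm]

section Quadrature

variable {s : ℕ} {c : Fin s → ℝ}

lemma eval_lagrangePoly (hc : Function.Injective c) (i : Fin s) (θ : ℝ) :
    (lagrangePoly c i).eval θ = ∑ j : Fin s, quadCoeff c i j * (θ ^ (j : ℕ) / ((j : ℕ)! : ℝ)) := by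
  have h : (lagrangePoly c i).natDegree < s := by
    rw [lagrangePoly, Lagrange.natDegree_basis hc.injOn (Finset.mem_univ i), Finset.card_univ,
      Fintype.card_fin]
    exact Nat.sub_lt (i.pos) one_pos
  rw [Polynomial.eval_eq_sum_range' h, Finset.sum_range]
  refine Finset.sum_congr rfl fun j _ => ?_
  have : (((j : ℕ)! : ℝ)) ≠ 0 := by positivity
  rw [quadCoeff]
  field_simp

lemma sum_quadCoeff_div_factorial (hc : Function.Injective c) (i : Fin s) (q : ℕ) :
    ∑ j : Fin s, 1 / ((q + (j + 1))! : ℝ) * quadCoeff c i j =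
      ∫ θ in (0 : ℝ)..1, (1 - θ) ^ q / (q ! : ℝ) * (lagrangePoly c i).eval θ := by
  simp only [eval_lagrangePoly hc, Finset.mul_sum, mul_left_comm _ (quadCoeff c i _)]
  rw [intervalIntegral.integral_finsetSum fun j _ =>
    (by fun_prop : Continuous _).intervalIntegrable _ _]
  refine Finset.sum_congr rfl fun j _ => ?_
  rw [intervalIntegral.integral_const_mul, integral_one_sub_pow_mul_pow, mul_comm, add_assoc]

/-- For an exact rule, interpolation of `θ ^ r` does not change the integral against
`(1 - θ) ^ q`: the difference either vanishes (`r < s`), or its product with `(1 - θ) ^ q` has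
degree less than `p` and vanishes at the nodes. -/
lemma QuadExact.integral_interpolate (hc : Function.Injective c) {p : ℕ} (hQ : QuadExact c p)
    {q r : ℕ} (hqr : q + r < p) :
    ∫ θ in (0 : ℝ)..1, (1 - θ) ^ q / (q ! : ℝ) *
        ∑ i, c i ^ r * (lagrangePoly c i).eval θ =
      ∫ θ in (0 : ℝ)..1, (1 - θ) ^ q / (q ! : ℝ) * θ ^ r := by
  let P : Polynomial ℝ := Lagrange.interpolate Finset.univ c (fun i => c i ^ r)
  have hP : ∀ θ, ∑ i, c i ^ r * (lagrangePoly c i).eval θ = P.eval θ := fun θ => by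
    simp [P, Lagrange.interpolate_apply, Polynomial.eval_finsetSum, lagrangePoly]
  have hdegP : P.degree < s := by
    have := Lagrange.degree_interpolate_lt (s := Finset.univ) (v := c)
      (fun i => c i ^ r) hc.injOn
    rwa [Finset.card_univ, Fintype.card_fin] at this
  simp only [hP]
  rcases lt_or_ge r s with hr | hr
  · have : P = Polynomial.X ^ r := by
      refine (Lagrange.eq_interpolate_of_eval_eq _ hc.injOn ?_ (by simp)).symm
      simpa using hr
    simp [this]
  · let e : Polynomial ℝ := (1 - Polynomial.X) ^ q * (P - Polynomial.X ^ r)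
    have hdeg : e.degree < p := by
      have h1 : (1 - Polynomial.X : Polynomial ℝ).degree ≤ 1 :=
        (Polynomial.degree_sub_le _ _).trans (by simp)
      have h2 : (P - Polynomial.X ^ r).degree ≤ (r : WithBot ℕ) := by
        refine (Polynomial.degree_sub_le _ _).trans (max_le (hdegP.le.trans ?_) (by simp))
        exact_mod_cast hr
      calc e.degree ≤ ((1 - Polynomial.X : Polynomial ℝ) ^ q).degree +
            (P - Polynomial.X ^ r).degree := Polynomial.degree_mul_le _ _
        _ ≤ q • (1 : WithBot ℕ) + r :=
          add_le_add ((Polynomial.degree_pow_le _ _).trans (nsmul_le_nsmul_right h1 q)) h2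
        _ = ((q + r : ℕ) : WithBot ℕ) := by simp
        _ < p := by exact_mod_cast hqr
    have hnode : ∀ i, e.eval (c i) = 0 := fun i => by
      have : P.eval (c i) = c i ^ r :=
        Lagrange.eval_interpolate_at_node _ hc.injOn (Finset.mem_univ i)
      simp [e, this]
    have h0 : ∫ θ in (0 : ℝ)..1, e.eval θ = 0 := by simpa [hnode] using hQ e hdeg
    rw [← sub_eq_zero, ← intervalIntegral.integral_sub]
    · refine Eq.trans ?_ (by rw [h0, mul_zero] :
        (1 / (q ! : ℝ)) * ∫ θ in (0 : ℝ)..1, e.eval θ = 0)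
      rw [← intervalIntegral.integral_const_mul]
      refine intervalIntegral.integral_congr fun θ _ => ?_
      simp [e]
      ring
    · exact (by fun_prop : Continuous _).intervalIntegrable _ _
    · exact (by fun_prop : Continuous _).intervalIntegrable _ _

/-- Exactness of the quadrature rule implies the order conditions. -/
lemma QuadExact.order_condition (hc : Function.Injective c) {p : ℕ} (hQ : QuadExact c p)
    {q r : ℕ} (hqr : q + r < p) :
    1 / (r ! : ℝ) * ∑ j : Fin s, 1 / ((q + (j + 1))! : ℝ) * ∑ i, c i ^ r * quadCoeff c i j =
      1 / ((q + r + 1)! : ℝ) := by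
  have h1 : ∑ j : Fin s, 1 / ((q + (j + 1))! : ℝ) * ∑ i, c i ^ r * quadCoeff c i j =
      ∫ θ in (0 : ℝ)..1, (1 - θ) ^ q / (q ! : ℝ) *
        ∑ i, c i ^ r * (lagrangePoly c i).eval θ := by
    simp only [Finset.mul_sum, mul_left_comm _ (c _ ^ r)]
    rw [Finset.sum_comm, intervalIntegral.integral_finsetSum fun j _ =>
      (by fun_prop : Continuous _).intervalIntegrable _ _]
    refine Finset.sum_congr rfl fun i _ => ?_
    rw [intervalIntegral.integral_const_mul, ← sum_quadCoeff_div_factorial hc, Finset.mul_sum]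
  rw [h1, hQ.integral_interpolate hc hqr, ← integral_one_sub_pow_mul_pow q r,
    ← intervalIntegral.integral_const_mul]
  refine intervalIntegral.integral_congr fun θ _ => ?_
  ring

end Quadrature

/-! ### Taylor expansion of the exact solution -/

/-- Taylor's formula with a remainder that is uniform in the centre of the expansion. -/
lemma exists_taylor_bound_uniform {E : Type*} [NormedAddCommGroup E] [NormedSpace ℝ E] {T : ℝ}
    (hT : 0 < T) {n : ℕ} {g : ℝ → E} (hg : ContDiffOn ℝ n g (Icc 0 T)) :
    ∃ C : ℝ, 0 ≤ C ∧ ∀ t ∈ Icc 0 T, ∀ x ∈ Icc t T,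
      ‖g x - ∑ r ∈ Finset.range n, ((x - t) ^ r / (r ! : ℝ)) •
        iteratedDerivWithin r g (Icc 0 T) t‖ ≤ C * (x - t) ^ n := by
  have hU := uniqueDiffOn_Icc hT
  obtain ⟨C, hC⟩ := isCompact_Icc.exists_bound_of_continuousOn
    (hg.continuousOn_iteratedDerivWithin le_rfl hU)
  refine ⟨max C 0, le_max_right _ _, fun t ht x hx => ?_⟩
  cases n with
  | zero =>
    have hx0 : x ∈ Icc 0 T := ⟨ht.1.trans hx.1, hx.2⟩
    simpa using Or.inl (hC x hx0)
  | succ n =>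
    rcases ht.2.lt_or_eq with htT | htT
    swap
    · have : x = t := le_antisymm (hx.2.trans htT.ge) hx.1
      rw [this, Finset.sum_eq_single 0]
      · simp
      · intro b _ hb; simp [hb]
      · simp
    have hsub : Icc t T ⊆ Icc 0 T := Icc_subset_Icc_left ht.1
    have hU' := uniqueDiffOn_Icc htT
    have heq : ∀ r ≤ n + 1, ∀ y ∈ Icc t T, iteratedDerivWithin r g (Icc t T) y =
        iteratedDerivWithin r g (Icc 0 T) y := fun r hr y hy => by
      rw [iteratedDerivWithin, iteratedDerivWithin,
        iteratedFDerivWithin_subset hsub hU' hU (hg.of_le (by exact_mod_cast hr)) hy]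
    have h := taylor_mean_remainder_bound (C := max C 0) ht.2 (hg.mono hsub) hx fun y hy => by
      rw [heq _ le_rfl y hy]
      exact (hC y (hsub hy)).trans (le_max_left _ _)
    rw [taylor_within_apply] at h
    have hsum : ∑ r ∈ Finset.range (n + 1), ((x - t) ^ r / (r ! : ℝ)) •
        iteratedDerivWithin r g (Icc 0 T) t = ∑ r ∈ Finset.range (n + 1),
        ((r ! : ℝ)⁻¹ * (x - t) ^ r) • iteratedDerivWithin r g (Icc t T) t :=
      Finset.sum_congr rfl fun r hr => by
        rw [heq r (Finset.mem_range.1 hr).le t (left_mem_Icc.2 ht.2), div_eq_inv_mul]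
    rw [hsum]
    refine h.trans (div_le_self ?_ ?_)
    · exact mul_nonneg (le_max_right _ _) (pow_nonneg (sub_nonneg.2 hx.1) _)
    · exact_mod_cast Nat.one_le_iff_ne_zero.2 (Nat.factorial_ne_zero n)

section Regularity

variable {X Y : Type*} [NormedAddCommGroup X] [NormedSpace ℂ X]
  [NormedAddCommGroup Y] [NormedSpace ℂ Y] {B : BoundaryPair X Y} {T : ℝ} {p : ℕ}
  {u₀ : X} {f u : ℝ → X} {g : ℝ → Y}

lemma IsRegularSolution.pow_source (hT : 0 < T) (hreg : IsRegularSolution B T p u)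
    (hu : IsIBVPSolution B T u₀ f g u) {l : ℕ} (hl : l ≤ p) {t : ℝ} (ht : t ∈ Icc 0 T) :
    B.pow l (f t) = derivWithin (fun r => B.pow l (u r)) (Icc 0 T) t - B.pow (l + 1) (u t) := by
  have hU := uniqueDiffOn_Icc hT t ht
  have h1 := hreg.commute l 1 (by omega) t ht
  have h2 := hreg.mem_dom l 1 (by omega) t ht
  have h3 := hreg.mem_dom (l + 1) 0 (by omega) t ht
  rw [iteratedDerivWithin_zero] at h3
  rw [iteratedDerivWithin_one, iteratedDerivWithin_one] at h1
  rw [iteratedDerivWithin_one] at h2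
  have h4 : f t = derivWithin u (Icc 0 T) t - B.op (u t) := by
    rw [(hu.deriv t ht).derivWithin hU, add_sub_cancel_left]
  rw [h1, h4, BoundaryPair.MemDomPow.pow_sub h2, B.pow_succ']
  intro i hi
  rw [← B.pow_succ']
  exact h3 (i + 1) (by omega)

lemma IsRegularSolution.contDiffOn_pow_source (hT : 0 < T) (hreg : IsRegularSolution B T p u)
    (hu : IsIBVPSolution B T u₀ f g u) {l n : ℕ} (hl : l + n = p) :
    ContDiffOn ℝ n (fun t => B.pow l (f t)) (Icc 0 T) := by
  have h1 := (hreg.contDiff l (n + 1) (by omega)).derivWithin (uniqueDiffOn_Icc hT) (m := n)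
    (by norm_cast)
  have h2 := hreg.contDiff (l + 1) n (by omega)
  exact (h1.sub h2).congr fun t ht => hreg.pow_source hT hu (by omega) ht

/-- `(A ^ l f)^(r) = A ^ l u^(r+1) - A ^ (l+1) u^(r)`. -/
lemma IsRegularSolution.iteratedDerivWithin_pow_source (hT : 0 < T)
    (hreg : IsRegularSolution B T p u) (hu : IsIBVPSolution B T u₀ f g u) {l r : ℕ}
    (hlr : l + r ≤ p) {t : ℝ} (ht : t ∈ Icc 0 T) :
    iteratedDerivWithin r (fun t => B.pow l (f t)) (Icc 0 T) t =
      B.pow l (iteratedDerivWithin (r + 1) u (Icc 0 T) t) -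
        B.pow (l + 1) (iteratedDerivWithin r u (Icc 0 T) t) := by
  have hU := uniqueDiffOn_Icc hT
  rw [iteratedDerivWithin_congr (fun t ht => hreg.pow_source hT hu (by omega) ht) ht]
  have h1 := (hreg.contDiff l (p + 1 - l) (by omega)).derivWithin hU (m := r)
    (by norm_cast; omega)
  have h2 := (hreg.contDiff (l + 1) (p - l) (by omega)).of_le (m := r) (by norm_cast; omega)
  have h3 := iteratedDerivWithin_sub ht hU (h1 t ht) (h2 t ht)
  refine h3.trans ?_
  rw [← iteratedDerivWithin_succ', hreg.commute l (r + 1) (by omega) t ht,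
    hreg.commute (l + 1) r (by omega) t ht]

/-- `A ^ l f^(r) = A ^ l u^(r+1) - A ^ (l+1) u^(r)`. -/
lemma IsRegularSolution.pow_iteratedDerivWithin_source (hT : 0 < T)
    (hreg : IsRegularSolution B T p u) (hu : IsIBVPSolution B T u₀ f g u) {l r : ℕ}
    (hlr : l + r ≤ p) {t : ℝ} (ht : t ∈ Icc 0 T) :
    B.pow l (iteratedDerivWithin r f (Icc 0 T) t) =
      B.pow l (iteratedDerivWithin (r + 1) u (Icc 0 T) t) -
        B.pow (l + 1) (iteratedDerivWithin r u (Icc 0 T) t) := by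
  have h0 := hreg.iteratedDerivWithin_pow_source hT hu (l := 0) (r := r) (by omega) ht
  simp only [B.pow_zero, zero_add] at h0
  rw [h0, BoundaryPair.MemDomPow.pow_sub (hreg.mem_dom l (r + 1) (by omega) t ht), B.pow_succ']
  · rfl
  intro i hi
  have := hreg.mem_dom (l + 1) r (by omega) t ht (i + 1) (by omega)
  exact this

end Regularity

/-! ### The local error of the time discretization -/

lemma sum_range_sum_range_sub {M : Type*} [AddCommMonoid M] (p : ℕ) (F : ℕ → ℕ → M) :
    ∑ l ∈ Finset.range p, ∑ r ∈ Finset.range (p - l), F l r =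
      ∑ m ∈ Finset.range p, ∑ r ∈ Finset.range (m + 1), F (m - r) r := by
  rw [Finset.sum_range_diag_flip p fun r l => F l r]
  exact Finset.sum_comm' fun l r => by simp only [Finset.mem_range]; omega

/-- The polynomial parts of `u(t + k)` and of the time step, for given values `a l j` of
`A ^ l u^(j)(t)`, differ by the expansion of the local error. -/
lemma sum_taylor_sub_sum_taylor {E : Type*} [AddCommGroup E] [Module ℝ E] (p : ℕ) {s : ℕ}
    (c : Fin s → ℝ) (k : ℝ) (a : ℕ → ℕ → E) :
    ∑ m ∈ Finset.range (p + 1), (k ^ m / (m ! : ℝ)) • a 0 m -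
      (∑ l ∈ Finset.range (p + 1), (k ^ l / (l ! : ℝ)) • a l 0 +
        k • ∑ i : Fin s, ∑ j : Fin s, quadCoeff c i j • ∑ l ∈ Finset.range p,
          (k ^ l / ((l + (j + 1))! : ℝ)) • ∑ r ∈ Finset.range (p - l),
            ((c i * k) ^ r / (r ! : ℝ)) • (a l (r + 1) - a (l + 1) r)) =
    ∑ m ∈ Finset.range p, k ^ (m + 1) • ∑ r ∈ Finset.range (m + 1),
      (1 / ((m + 1)! : ℝ) - 1 / (r ! : ℝ) *
        ∑ l : Fin s, 1 / ((m - r + (l + 1))! : ℝ) * ∑ i : Fin s, c i ^ r * quadCoeff c i l) •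
        (a (m - r) (r + 1) - a (m - r + 1) r) := by
  have htel : ∀ m, a 0 (m + 1) - a (m + 1) 0 =
      ∑ r ∈ Finset.range (m + 1), (a (m - r) (r + 1) - a (m - r + 1) r) := by
    intro m
    have h := Finset.sum_range_sub (fun r => a (m + 1 - r) r) (m + 1)
    simp only [Nat.sub_self, Nat.sub_zero] at h
    rw [← h]
    refine Finset.sum_congr rfl fun r hr => ?_
    have := Finset.mem_range.1 hr
    rw [show m + 1 - (r + 1) = m - r by omega, show m + 1 - r = m - r + 1 by omega]
  have hquad : k • ∑ i : Fin s, ∑ j : Fin s, quadCoeff c i j • ∑ l ∈ Finset.range p,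
          (k ^ l / ((l + (j + 1))! : ℝ)) • ∑ r ∈ Finset.range (p - l),
            ((c i * k) ^ r / (r ! : ℝ)) • (a l (r + 1) - a (l + 1) r) =
      ∑ m ∈ Finset.range p, k ^ (m + 1) • ∑ r ∈ Finset.range (m + 1), (1 / (r ! : ℝ) *
        ∑ l : Fin s, 1 / ((m - r + (l + 1))! : ℝ) * ∑ i : Fin s, c i ^ r * quadCoeff c i l) •
        (a (m - r) (r + 1) - a (m - r + 1) r) := by
    simp only [Finset.smul_sum, smul_smul, Finset.mul_sum, Finset.sum_smul,
      sum_range_sum_range_sub p]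
    rw [Finset.sum_comm]
    simp only [Finset.sum_comm (s := Finset.univ) (t := Finset.range _)]
    refine Finset.sum_congr rfl fun m _ => Finset.sum_congr rfl fun r hr =>
      Finset.sum_congr rfl fun j _ => Finset.sum_congr rfl fun i _ => ?_
    congr 1
    obtain ⟨d, rfl⟩ := Nat.exists_eq_add_of_le' (Nat.lt_succ_iff.1 (Finset.mem_range.1 hr))
    rw [Nat.add_sub_cancel]
    ring
  have hu : ∑ m ∈ Finset.range (p + 1), (k ^ m / (m ! : ℝ)) • a 0 m -
      ∑ l ∈ Finset.range (p + 1), (k ^ l / (l ! : ℝ)) • a l 0 =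
      ∑ m ∈ Finset.range p, k ^ (m + 1) • ∑ r ∈ Finset.range (m + 1),
        (1 / ((m + 1)! : ℝ)) • (a (m - r) (r + 1) - a (m - r + 1) r) := by
    rw [← Finset.sum_sub_distrib, Finset.sum_range_succ']
    simp only [← smul_sub, sub_self, add_zero]
    refine Finset.sum_congr rfl fun m _ => ?_
    rw [htel, ← Finset.smul_sum, smul_smul, mul_one_div]
  rw [hquad, ← sub_sub, hu, ← Finset.sum_sub_distrib]
  refine Finset.sum_congr rfl fun m _ => ?_
  rw [← smul_sub, ← Finset.sum_sub_distrib]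
  simp only [sub_smul]

section LocalError

variable {X Y : Type*} [NormedAddCommGroup X] [NormedSpace ℂ X]
  [NormedAddCommGroup Y] [NormedSpace ℂ Y] {B : BoundaryPair X Y} {S : ℝ → X →L[ℂ] X} {T : ℝ}
  {p : ℕ} {u₀ : X} {f u : ℝ → X} {g : ℝ → Y}

lemma localErrorExpansion_eq (hT : 0 < T) (hreg : IsRegularSolution B T p u)
    (hu : IsIBVPSolution B T u₀ f g u) {s : ℕ} (c : Fin s → ℝ) {k : ℝ} {n : ℕ}
    (ht : (n * k : ℝ) ∈ Icc 0 T) :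
    localErrorExpansion B T p c f k n =
      ∑ m ∈ Finset.range p, k ^ (m + 1) • ∑ r ∈ Finset.range (m + 1),
        (1 / ((m + 1)! : ℝ) - 1 / (r ! : ℝ) *
          ∑ l : Fin s, 1 / ((m - r + (l + 1))! : ℝ) * ∑ i : Fin s, c i ^ r * quadCoeff c i l) •
          (B.pow (m - r) (iteratedDerivWithin (r + 1) u (Icc 0 T) (n * k)) -
            B.pow (m - r + 1) (iteratedDerivWithin r u (Icc 0 T) (n * k))) := by
  refine Finset.sum_congr rfl fun m hm => congrArg _ (Finset.sum_congr rfl fun r hr => ?_)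
  rw [Finset.mem_range] at hm hr
  rw [hreg.pow_iteratedDerivWithin_source hT hu (by omega) ht]

/-- The local error is its expansion up to Taylor remainders and terms `k ^ (p + 1) φ`. -/
lemma exists_norm_timeLocalError_sub_le (hB : B.Admissible S) (hT : 0 < T)
    (hreg : IsRegularSolution B T p u) (hu : IsIBVPSolution B T u₀ f g u) {s : ℕ} {c : Fin s → ℝ}
    (hc01 : ∀ i, c i ∈ Icc (0 : ℝ) 1) :
    ∃ C : ℝ, ∀ n : ℕ, ∀ k : ℝ, 0 < k → ((n + 1 : ℕ) : ℝ) * k ≤ T →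
      ‖timeLocalError B S p c f u k n - localErrorExpansion B T p c f k n‖ ≤ C * k ^ (p + 1) := by
  obtain ⟨M, hM0, hM⟩ := hB.exists_norm_le
  obtain ⟨Cu, -, hCu⟩ := exists_taylor_bound_uniform hT (hreg.contDiff 0 (p + 1) (by omega))
  have hf : ∀ l, ∃ C : ℝ, 0 ≤ C ∧ (l ≤ p → ∀ t ∈ Icc 0 T, ∀ x ∈ Icc t T,
      ‖B.pow l (f x) - ∑ r ∈ Finset.range (p - l), ((x - t) ^ r / (r ! : ℝ)) •
        iteratedDerivWithin r (fun t => B.pow l (f t)) (Icc 0 T) t‖ ≤ C * (x - t) ^ (p - l)) := by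
    intro l
    by_cases hl : l ≤ p
    · obtain ⟨C, hC0, hC⟩ := exists_taylor_bound_uniform hT
        (hreg.contDiffOn_pow_source hT hu (Nat.add_sub_cancel' hl))
      exact ⟨C, hC0, fun _ => hC⟩
    · exact ⟨0, le_rfl, fun h => absurd h hl⟩
  choose Cf hCf0 hCf using hf
  obtain ⟨N₁, hN₁⟩ := isCompact_Icc.exists_bound_of_continuousOn
    (hreg.contDiff (p + 1) 0 (by omega)).continuousOn
  obtain ⟨N₂, hN₂⟩ := isCompact_Icc.exists_bound_of_continuousOn
    (hreg.contDiffOn_pow_source hT hu (add_zero p)).continuousOn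
  set a₁ := ∑ i : Fin s, ∑ j : Fin s, |quadCoeff c i j|
  refine ⟨Cu + M * N₁ + a₁ * (∑ l ∈ Finset.range p, Cf l + M * N₂), fun n k hk hnk => ?_⟩
  have hnk' : n * k + k ≤ T := by push_cast at hnk; linarith
  have ht : (n * k : ℝ) ∈ Icc 0 T := ⟨by positivity, by linarith⟩
  rw [localErrorExpansion_eq hT hreg hu c ht, timeLocalError,
    show ((n + 1 : ℕ) : ℝ) * k = n * k + k by push_cast; ring]
  generalize (n * k : ℝ) = t at ht hnk'
  rw [← sum_taylor_sub_sum_taylor p c k fun l j => B.pow l (iteratedDerivWithin j u (Icc 0 T) t)]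
  have hx : ∀ i, t + c i * k ∈ Icc t T := fun i =>
    ⟨by nlinarith [(hc01 i).1], by nlinarith [(hc01 i).2]⟩
  let b : Fin s → Fin s → X := fun i j => ∑ l ∈ Finset.range p,
    (k ^ l / ((l + (j + 1))! : ℝ)) • (B.pow l (f (t + c i * k)) - ∑ r ∈ Finset.range (p - l),
      ((c i * k) ^ r / (r ! : ℝ)) • (B.pow l (iteratedDerivWithin (r + 1) u (Icc 0 T) t) -
        B.pow (l + 1) (iteratedDerivWithin r u (Icc 0 T) t)))
    + k ^ p • phi S (p + (j + 1)) k (B.pow p (f (t + c i * k)))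
  have hsplit : u (t + k) - timeStep B S p c f k t (u t) -
      (∑ m ∈ Finset.range (p + 1), (k ^ m / (m ! : ℝ)) •
          B.pow 0 (iteratedDerivWithin m u (Icc 0 T) t) -
        (∑ l ∈ Finset.range (p + 1), (k ^ l / (l ! : ℝ)) •
            B.pow l (iteratedDerivWithin 0 u (Icc 0 T) t) +
          k • ∑ i : Fin s, ∑ j : Fin s, quadCoeff c i j • ∑ l ∈ Finset.range p,
            (k ^ l / ((l + (j + 1))! : ℝ)) • ∑ r ∈ Finset.range (p - l),
              ((c i * k) ^ r / (r ! : ℝ)) •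
                (B.pow l (iteratedDerivWithin (r + 1) u (Icc 0 T) t) -
                  B.pow (l + 1) (iteratedDerivWithin r u (Icc 0 T) t)))) =
      (u (t + k) - ∑ m ∈ Finset.range (p + 1), (k ^ m / (m ! : ℝ)) •
          iteratedDerivWithin m u (Icc 0 T) t) -
        k ^ (p + 1) • phi S (p + 1) k (B.pow (p + 1) (u t)) -
        k • ∑ i : Fin s, ∑ j : Fin s, quadCoeff c i j • b i j := by
    simp only [b, timeStep, iteratedDerivWithin_zero, B.pow_zero, smul_add (quadCoeff _ _ _),
      smul_sub (_ / _) (B.pow _ (f _)), Finset.sum_sub_distrib (f := fun l => _ • B.pow l (f _)),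
      smul_sub (quadCoeff _ _ _), Finset.sum_add_distrib, Finset.sum_sub_distrib]
    rw [smul_add, smul_add, smul_sub]
    abel
  have hb : ∀ i j, ‖b i j‖ ≤ k ^ p * (∑ l ∈ Finset.range p, Cf l + M * N₂) := by
    intro i j
    have hx0 : t + c i * k ∈ Icc 0 T := ⟨ht.1.trans (hx i).1, (hx i).2⟩
    rw [mul_add, Finset.mul_sum]
    refine (norm_add_le _ _).trans (add_le_add (norm_sum_le_of_le _ fun l hl => ?_) ?_)
    · have hl := Finset.mem_range.1 hl
      have h1 := hCf l hl.le t ht _ (hx i)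
      rw [add_sub_cancel_left] at h1
      have h2 : ∀ r ∈ Finset.range (p - l), ((c i * k) ^ r / (r ! : ℝ)) •
          iteratedDerivWithin r (fun t => B.pow l (f t)) (Icc 0 T) t =
          ((c i * k) ^ r / (r ! : ℝ)) • (B.pow l (iteratedDerivWithin (r + 1) u (Icc 0 T) t) -
            B.pow (l + 1) (iteratedDerivWithin r u (Icc 0 T) t)) := fun r hr => by
        have := Finset.mem_range.1 hr
        rw [hreg.iteratedDerivWithin_pow_source hT hu (by omega) ht]
      rw [Finset.sum_congr rfl h2] at h1
      have h3 : (c i * k) ^ (p - l) ≤ k ^ (p - l) :=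
        pow_le_pow_left₀ (mul_nonneg (hc01 i).1 hk.le)
          (mul_le_of_le_one_left hk.le (hc01 i).2) _
      have h4 : k ^ l / ((l + (j + 1))! : ℝ) ≤ k ^ l :=
        div_le_self (by positivity)
          (by exact_mod_cast Nat.one_le_iff_ne_zero.2 (Nat.factorial_ne_zero _))
      rw [norm_smul, Real.norm_of_nonneg (by positivity)]
      calc _ ≤ k ^ l * (Cf l * k ^ (p - l)) :=
            mul_le_mul h4 (h1.trans (mul_le_mul_of_nonneg_left h3 (hCf0 l))) (norm_nonneg _)
              (by positivity)
        _ = k ^ (l + (p - l)) * Cf l := by rw [pow_add]; ring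
        _ = k ^ p * Cf l := by rw [Nat.add_sub_cancel' hl.le]
    · rw [norm_smul, Real.norm_of_nonneg (by positivity)]
      exact mul_le_mul_of_nonneg_left ((norm_phi_le hM _ _ hk).trans
        (mul_le_mul_of_nonneg_left (hN₂ _ hx0) hM0)) (by positivity)
  have h1 := hCu t ht (t + k) ⟨by linarith, hnk'⟩
  rw [add_sub_cancel_left] at h1
  have h2 : ‖k ^ (p + 1) • phi S (p + 1) k (B.pow (p + 1) (u t))‖ ≤ k ^ (p + 1) * (M * N₁) := by
    rw [norm_smul, Real.norm_of_nonneg (by positivity)]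
    exact mul_le_mul_of_nonneg_left ((norm_phi_le hM _ _ hk).trans
      (mul_le_mul_of_nonneg_left (hN₁ _ ht) hM0)) (by positivity)
  have h3 : ‖k • ∑ i : Fin s, ∑ j : Fin s, quadCoeff c i j • b i j‖ ≤
      k * (a₁ * (k ^ p * (∑ l ∈ Finset.range p, Cf l + M * N₂))) := by
    rw [norm_smul, Real.norm_of_nonneg hk.le]
    refine mul_le_mul_of_nonneg_left ?_ hk.le
    simp only [a₁, Finset.sum_mul]
    refine norm_sum_le_of_le _ fun i _ => norm_sum_le_of_le _ fun j _ => ?_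
    rw [norm_smul, Real.norm_eq_abs]
    exact mul_le_mul_of_nonneg_left (hb i j) (abs_nonneg _)
  rw [hsplit]
  refine ((norm_sub_le _ _).trans (add_le_add ((norm_sub_le _ _).trans (add_le_add h1 h2))
    h3)).trans (le_of_eq ?_)
  ring

/-- The order conditions of an exact quadrature rule annihilate the expansion. -/
lemma QuadExact.localErrorExpansion_eq_zero {s : ℕ} {c : Fin s → ℝ} (hc : Function.Injective c)
    (hQ : QuadExact c p) (k : ℝ) (n : ℕ) : localErrorExpansion B T p c f k n = 0 := by
  refine Finset.sum_eq_zero fun m hm => ?_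
  rw [Finset.sum_eq_zero fun r hr => ?_, smul_zero]
  rw [Finset.mem_range] at hm hr
  rw [hQ.order_condition hc (by omega), Nat.sub_add_cancel (Nat.lt_succ_iff.1 hr), sub_self,
    zero_smul]

end LocalError

theorem mainTheorem3
    {X Y Z : Type*} [NormedAddCommGroup X] [NormedSpace ℂ X] [CompleteSpace X]
    [NormedAddCommGroup Y] [NormedSpace ℂ Y] [CompleteSpace Y]
    [NormedAddCommGroup Z] [NormedSpace ℂ Z]
    (B : BoundaryPair X Y) (S : ℝ → X →L[ℂ] X) (hB : B.Admissible S)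
    (T : ℝ) (hT : 0 < T) (u₀ : X) (f : ℝ → X) (g : ℝ → Y) (u : ℝ → X)
    (hu : IsIBVPSolution B T u₀ f g u)
    (p : ℕ) (hp : 1 ≤ p) (hreg : IsRegularSolution B T p u)
    (s : ℕ) (hs : 1 ≤ s) (c : Fin s → ℝ) (hc : Function.Injective c)
    (hc01 : ∀ i, c i ∈ Icc (0 : ℝ) 1)
    (ι : Z →ₗ[ℂ] X) (hZ : SmoothSubspace B S ι T p s)
    (huZ : ∀ j ≤ p + 1, ContinuousInto ι T (fun t => B.pow j (u t)))
    (hfZ : ∀ j ≤ p, ContinuousInto ι T (fun t => B.pow j (f t)))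
    {Xh : ℕ → Type*} [∀ m, NormedAddCommGroup (Xh m)] [∀ m, NormedSpace ℂ (Xh m)]
    [∀ m, FiniteDimensional ℂ (Xh m)] (D : ∀ m, SpaceDiscretization X Y (Xh m))
    (h ε : ℕ → ℝ) (hD : DiscretizationFamily B ι D h ε) :
    -- the global error bound, for `P_h` bounded uniformly in `h`
    ((∃ C : ℝ, ∀ m, ∀ z : Z, ‖(D m).P B (ι z)‖ ≤ C * ‖ι z‖) →
      ∃ C : ℝ, ∀ m n : ℕ, ∀ k : ℝ, 0 < k → n * k ≤ T →
        ‖(D m).P B (u (n * k)) - (D m).scheme B p c u₀ f u k n‖ ≤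
          C * (1 / k * (⨆ l : Fin n, ‖timeLocalError B S p c f u k l‖) + ε m)) ∧
    -- the global error bound without that assumption
    (∃ C : ℝ, ∀ m n : ℕ, ∀ k : ℝ, 0 < k → n * k ≤ T →
      ‖(D m).P B (u (n * k)) - (D m).scheme B p c u₀ f u k n‖ ≤
        C * (1 / k * (⨆ l : Fin n, (‖timeLocalError B S p c f u k l‖
          + ‖B.trace (timeLocalError B S p c f u k l)‖)) + ε m)) ∧
    -- the bounds for the local errors of the time semidiscretization
    (∃ C : ℝ, ∀ n : ℕ, ∀ k : ℝ, 0 < k → ((n + 1 : ℕ) : ℝ) * k ≤ T →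
      ‖timeLocalError B S p c f u k n - localErrorExpansion B T p c f k n‖ ≤ C * k ^ (p + 1)) ∧
    (QuadExact c p →
      ∃ C : ℝ, ∀ n : ℕ, ∀ k : ℝ, 0 < k → ((n + 1 : ℕ) : ℝ) * k ≤ T →
        ‖timeLocalError B S p c f u k n‖ ≤ C * k ^ (p + 1)) := by
  refine ⟨fun hP => ?_, ?_, ?_, fun hQ => ?_⟩
  · exact exists_norm_error_le hB hT hp hs hc01 hu.init hZ huZ hfZ hD (fun x => ‖x‖)
      (fun x => norm_nonneg x) hP
  · obtain ⟨C, hC⟩ := hD.exists_norm_P_le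
    exact exists_norm_error_le hB hT hp hs hc01 hu.init hZ huZ hfZ hD
      (fun x => ‖x‖ + ‖B.trace x‖) (fun x => by positivity) ⟨C, fun m z => hC m (ι z)⟩
  · exact exists_norm_timeLocalError_sub_le hB hT hreg hu hc01
  · obtain ⟨C, hC⟩ := exists_norm_timeLocalError_sub_le hB hT hreg hu hc01
    refine ⟨C, fun n k hk hnk => ?_⟩
    have h := hC n k hk hnk
    rwa [hQ.localErrorExpansion_eq_zero hc, sub_zero] at h
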